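/- **Setting.** Let $L\ge 1$. A convolutional architecture with $L$ layers has activation spaces $\mathbb{R}^{U_k\times w_k}$ ($U_k$ channels, $w_k$ spatial positions, $0\le k\le L$). The $\ell$-th layer ($1\le \ell\le L$) has $O_{\ell-1}\ge1$ patches $S^{\ell-1,1},\dots,S^{\ell-1,O_{\ell-1}}$, each an ordered set of $d_{\ell-1}\geq 1$ distinct coordinates of $\mathbb{R}^{U_{\ell-1}\times w_{\ell-1}}$, and an activation map $\sigma_\ell:\mathbb{R}^{U_\ell\times O_{\ell-1}}\to\mathbb{R}^{U_\ell\times w_\ell}$ (nonlinearity and pooling) which is $\rho_\ell$-Lipschitz for the sup norms and satisfies $\sigma_\ell(0)=0$. All $U_k,w_k$ are at least $1$. A filter matrix $A_\ell\in\mathbb{R}^{U_\ell\times d_{\ell-1}}$ acts by the convolution $\Lambda_{A_\ell}(x)_{j,o}=\sum_{i=1}^{d_{\ell-1}}(A_\ell)_{j,i}\,x_{S^{\ell-1,o}_i}$, whose matrix is $\mathrm{op}(A_\ell)$, and the network is $F_A=\sigma_L\circ\Lambda_{A_L}\circ\cdots\circ\sigma_1\circ\Lambda_{A_1}$. Write $\mathcal{W}=\sum_{\ell=1}^L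 d_{\ell-1}U_\ell$ and $\mathcal{A}=U_0w_0+\sum_{\ell=1}^L U_\ell O_{\ell-1}$. Norms: $\|x\|$ is the Euclidean norm of an input, $\|Z\|$ the spectral norm of a matrix, $\|Z^\top\|_{2,\infty}$ the largest Euclidean norm of a row of $Z$. Let $\mathcal{Y}$ be a measurable space and let $\mathrm{l}:\mathbb{R}^{U_L\times w_L}\times\mathcal{Y}\to[0,M]$ be a measurable loss that is $\lambda$-Lipschitz in its first argument for the sup norm. Let $(x_1,y_1),\dots,(x_N,y_N)$, $N\ge1$, be i.i.d. from a probability distribution $\mathcal{D}$ on $\mathbb{R}^{U_0\times w_0}\times\mathcal{Y}$, let $\delta\in(0,1)$, and put $$\mathrm{GAP}(A)=\mathbb{E}_{(x,y)\sim\mathcal{D}}[\mathrm{l}(F_A(x),y)]-\frac1N\sum_{i=1}^N \mathrm{l}(F_A(x_i),y_i).$$ **Theorem.** (a) *A priori version.* Let $b,s_1,\dots,s_L$ be real numbers and $\tilde r_1,\dots,\tilde r_L$ natural numbers, and suppose that $\|x\|\le b$ almost surely. With probability at least $1-\delta$ over the training set, every $A=(A_1,\dots,A_L)$ with $\|\mathrm{op}(A_\ell)\|\le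 s_\ell$ for $\ell<L$, $\|A_L^\top\|_{2,\infty}\le s_L$ and $\mathrm{rank}(A_\ell)\le\tilde r_\ell$ for all $\ell$ satisfies $$\mathrm{GAP}(A)\le 6(M+1)\sqrt{\frac{\log(4/\delta)}{N}}+\frac{208\sqrt{\log_2(4\underline\Gamma)}\,\log(N)\,(M+1)}{\sqrt N}\sum_{\ell=1}^L(U_\ell+d_{\ell-1})\,\tilde r_\ell,$$ where $\underline\Gamma=(b+1)(L\lambda+1)\,\mathcal{W}\mathcal{A}N\prod_{i=1}^L\big[(\rho_i+1)s_i+1\big]$. (b) *Post hoc version.* With probability at least $1-\delta$ over the training set, every $A=(A_1,\dots,A_L)$ satisfies $$\mathrm{GAP}(A)\le 6(M+1)\sqrt{\frac{\log(4/\delta)}{N}}+\frac{208\sqrt{\log_2(4\Gamma_R)}\,\log(N)\,(M+1)}{\sqrt N}\sum_{\ell=1}^L(U_\ell+d_{\ell-1})\,\mathrm{rank}(A_\ell),$$ where $\Gamma_R=(\mathfrak{B}+2)(L\lambda+1)\,\mathcal{W}\mathcal{A}N\prod_{i=1}^L\big[(\rho_i+1)(\|A_i\|+2)+1\big]$ and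 $\mathfrak{B}=\max_{i\le N}\|x_i\|$. No bound on the inputs is assumed here. (The exceptional event in (a) and in (b) has outer probability at most $\delta$.) -/

import Mathlib

open MeasureTheory
open scoped NNReal ENNReal

noncomputable section

namespace CNN

/-- Euclidean norm of a real vector indexed by a finite type. -/
def l2Norm {ι : Type*} [Fintype ι] (x : ι → ℝ) : ℝ :=
  Real.sqrt (∑ i, x i ^ 2)

/-- Spectral norm of a real matrix: its operator norm between Euclidean spaces. -/
def spectralNorm {m n : Type*} [Fintype m] [Fintype n] [DecidableEq n]
    (A : Matrix m n ℝ) : ℝ :=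
  ‖LinearMap.toContinuousLinearMap (Matrix.toEuclideanLin A)‖

/-- `‖Aᵀ‖_{2,∞}`: the largest Euclidean norm of a row of `A`. -/
def maxRowNorm {m n : Type*} [Fintype n] (A : Matrix m n ℝ) : ℝ :=
  ⨆ j, l2Norm (A j)

/-- A convolutional architecture with `L` layers. The index `k : Fin (L + 1)` runs over the
activation spaces `0, …, L`; the index `ℓ : Fin L` stands for the layer that maps space `ℓ` to
space `ℓ + 1`, so `patchDim ℓ`, `numPatches ℓ` are `d_ℓ`, `O_ℓ`, and `act ℓ`, `rho ℓ` are
the activation map (elementwise nonlinearity and pooling) that produces space `ℓ + 1` and its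
Lipschitz constant with respect to the sup norm (the norm of the function type). -/
structure Architecture (L : ℕ) where
  channels : Fin (L + 1) → ℕ
  spatial : Fin (L + 1) → ℕ
  patchDim : Fin L → ℕ
  numPatches : Fin L → ℕ
  channels_pos : ∀ k, 0 < channels k
  spatial_pos : ∀ k, 0 < spatial k
  patchDim_pos : ∀ ℓ, 0 < patchDim ℓ
  numPatches_pos : ∀ ℓ, 0 < numPatches ℓ
  /-- The patch number `o`: an ordered set of `d_ℓ` distinct coordinates of space `ℓ`. -/
  patch : ∀ ℓ : Fin L, Fin (numPatches ℓ) →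
    (Fin (patchDim ℓ) ↪ Fin (channels ℓ.castSucc) × Fin (spatial ℓ.castSucc))
  act : ∀ ℓ : Fin L, (Fin (channels ℓ.succ) × Fin (numPatches ℓ) → ℝ) →
    (Fin (channels ℓ.succ) × Fin (spatial ℓ.succ) → ℝ)
  rho : Fin L → ℝ≥0
  act_lipschitz : ∀ ℓ, LipschitzWith (rho ℓ) (act ℓ)
  act_zero : ∀ ℓ, act ℓ 0 = 0

namespace Architecture

variable {L : ℕ} (a : Architecture L)

/-- The activation space `ℝ^{U_k × w_k}`. -/
abbrev Act (k : Fin (L + 1)) : Type := Fin (a.channels k) × Fin (a.spatial k) → ℝ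

/-- The input space `ℝ^{U_0 × w_0}`. -/
abbrev Input : Type := a.Act 0

/-- The output space `ℝ^{U_L × w_L}`. -/
abbrev Output : Type := a.Act (Fin.last L)

/-- The trainable parameters: one filter matrix in `ℝ^{U_{ℓ+1} × d_ℓ}` for each layer. -/
abbrev Filters : Type :=
  ∀ ℓ : Fin L, Matrix (Fin (a.channels ℓ.succ)) (Fin (a.patchDim ℓ)) ℝ

/-- The convolution `Λ_A`: every row of `A` is applied to every patch. -/
def conv (ℓ : Fin L) (A : Matrix (Fin (a.channels ℓ.succ)) (Fin (a.patchDim ℓ)) ℝ)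
    (x : a.Act ℓ.castSucc) : Fin (a.channels ℓ.succ) × Fin (a.numPatches ℓ) → ℝ :=
  fun jo => ∑ i, x (a.patch ℓ jo.2 i) * A jo.1 i

/-- `op(A)`: the matrix of the linear map `Λ_A`. -/
def convMatrix (ℓ : Fin L) (A : Matrix (Fin (a.channels ℓ.succ)) (Fin (a.patchDim ℓ)) ℝ) :
    Matrix (Fin (a.channels ℓ.succ) × Fin (a.numPatches ℓ))
      (Fin (a.channels ℓ.castSucc) × Fin (a.spatial ℓ.castSucc)) ℝ :=
  Matrix.of fun jo u => ∑ i, if a.patch ℓ jo.2 i = u then A jo.1 i else 0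

theorem convMatrix_mulVec (ℓ : Fin L)
    (A : Matrix (Fin (a.channels ℓ.succ)) (Fin (a.patchDim ℓ)) ℝ) (x : a.Act ℓ.castSucc) :
    (a.convMatrix ℓ A).mulVec x = a.conv ℓ A x := by
  funext jo
  simp only [convMatrix, conv, Matrix.mulVec, dotProduct, Matrix.of_apply, Finset.sum_mul]
  rw [Finset.sum_comm]
  refine Finset.sum_congr rfl fun i _ => ?_
  simp [mul_comm]

/-- The activations at level `k` of the network with filters `A` on the input `x`. -/
def forward (A : a.Filters) (x : a.Input) (k : Fin (L + 1)) : a.Act k :=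
  Fin.induction (motive := fun k => a.Act k) x (fun ℓ h => a.act ℓ (a.conv ℓ (A ℓ) h)) k

/-- The network `F_A = σ_L ∘ Λ_{A_L} ∘ ⋯ ∘ σ_1 ∘ Λ_{A_1}`. -/
def net (A : a.Filters) (x : a.Input) : a.Output := a.forward A x (Fin.last L)

/-- The number of parameters `𝒲 = ∑_ℓ d_{ℓ-1} U_ℓ`. -/
def numParams : ℕ := ∑ ℓ : Fin L, a.patchDim ℓ * a.channels ℓ.succ

/-- The number `𝒜 = U_0 w_0 + ∑_{ℓ ≥ 1} U_ℓ O_{ℓ-1}` of input coordinates and preactivations. -/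
def numPreacts : ℕ :=
  a.channels 0 * a.spatial 0 + ∑ ℓ : Fin L, a.channels ℓ.succ * a.numPatches ℓ

/-- `∑_ℓ (U_ℓ + d_{ℓ-1}) r_ℓ`. -/
def lowRankCount (r : Fin L → ℕ) : ℕ :=
  ∑ ℓ : Fin L, (a.channels ℓ.succ + a.patchDim ℓ) * r ℓ

/-- The population risk minus the empirical risk of the network with filters `A`. -/
def gap {Y : Type*} [MeasurableSpace Y] (loss : a.Output → Y → ℝ)
    (D : Measure (a.Input × Y)) {N : ℕ} (z : Fin N → a.Input × Y) (A : a.Filters) : ℝ :=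
  (∫ q, loss (a.net A q.1) q.2 ∂D) - (1 / (N : ℝ)) * ∑ i, loss (a.net A (z i).1) (z i).2

/-- The logarithmic constant for inputs of norm at most `b` and norm constraints `s`:
`(b+1)(L·lip+1) 𝒲 𝒜 N ∏_i ((ρ_i+1) s_i + 1)`. -/
def gammaFixed (lip : ℝ≥0) (N : ℕ) (b : ℝ) (s : Fin L → ℝ) : ℝ :=
  (b + 1) * (L * lip + 1) * a.numParams * a.numPreacts * N *
    ∏ ℓ, ((a.rho ℓ + 1) * s ℓ + 1)

/-- The post hoc logarithmic constant, with `B` the largest norm of a training input: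
`(B+2)(L·lip+1) 𝒲 𝒜 N ∏_i ((ρ_i+1)(‖A_i‖+2) + 1)`. -/
def gammaPostHoc (lip : ℝ≥0) (N : ℕ) (B : ℝ) (A : a.Filters) : ℝ :=
  (B + 2) * (L * lip + 1) * a.numParams * a.numPreacts * N *
    ∏ ℓ, ((a.rho ℓ + 1) * (spectralNorm (A ℓ) + 2) + 1)

/-- The a priori constraints: `‖op(A_ℓ)‖ ≤ s_ℓ` below the last layer, `‖A_Lᵀ‖_{2,∞} ≤ s_L` at
the last layer, and `rank A_ℓ ≤ r_ℓ` at every layer. -/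
def Constrained (s : Fin L → ℝ) (r : Fin L → ℕ) (A : a.Filters) : Prop :=
  (∀ ℓ : Fin L, (ℓ : ℕ) + 1 < L → spectralNorm (a.convMatrix ℓ (A ℓ)) ≤ s ℓ) ∧
  (∀ ℓ : Fin L, (ℓ : ℕ) + 1 = L → maxRowNorm (A ℓ) ≤ s ℓ) ∧
  ∀ ℓ : Fin L, (A ℓ).rank ≤ r ℓ

end Architecture

/-- `𝔅 = max_i ‖x_i‖`, over the inputs of the sample. -/
def sampleRadius {ι : Type*} [Fintype ι] {Y : Type*} {N : ℕ} (z : Fin N → (ι → ℝ) × Y) : ℝ :=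
  ⨆ i, l2Norm (z i).1

/-- `6(M+1)√(log(4/δ)/N) + 208 √(log₂(4Γ)) log(N) (M+1)/√N · S`, where `M` bounds the loss. -/
def genBound (M δ : ℝ) (N : ℕ) (Γ S : ℝ) : ℝ :=
  6 * (M + 1) * Real.sqrt (Real.log (4 / δ) / N) +
    208 * Real.sqrt (Real.logb 2 (4 * Γ)) * Real.log N * (M + 1) / Real.sqrt N * S

end CNN

end

/-! The proof counts parameters. A rank-`r` filter in `ℝ^{U×d}` is a product of two factors with `(U
+ d) r` entries in total. Rounding these entries to a grid replaces all admissible filters by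
`(2m+1)^S` candidates, where `S = ∑ (U_ℓ + d_{ℓ-1}) r_ℓ` (`exists_gridMatrix_near`,
`card_gridIndex`). All norm constraints enter only through the bounds they give on single filter
entries. A relative error in the filters propagates through the layers with a constant exponential
in `L` (`norm_net_sub_le`), which costs only a logarithm in the mesh. Hoeffding's inequality and a
union bound over the grid then give a deviation of order `√(S · L · log Γ / N)`. The claimed bound
is linear in `S`, and `S ≥ 2L` when no rank is zero, so the factor `L` is absorbed
(`deviation_le_genBound`). If some rank is zero, the network is constantly zero and one function
suffices.

In the post hoc version the inputs are unbounded. A deterministic level `K` is chosen with `D(‖x‖ >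
K) ≤ log(4/δ)/N` and, with high probability, `K ≤ 𝔅 + 1` (`exists_tail_level`). Losses beyond `K`
are set to zero at the price of that mass. A union bound over dyadic entry bounds `2^n` and all rank
vectors removes the a priori parameters.

Exceptional events are only included in unions of simpler ones, so outer measure suffices
throughout. -/

namespace CNN

/-! ### Entrywise bounds from matrix and vector norms. -/

section Norms

variable {m n : Type*} [Fintype m] [Fintype n]

theorem abs_apply_le_l2Norm (x : n → ℝ) (i : n) : |x i| ≤ l2Norm x := by
  rw [← Real.sqrt_sq_eq_abs]
  exact Real.sqrt_le_sqrt
    (Finset.single_le_sum (f := fun i => x i ^ 2) (fun _ _ => sq_nonneg _) (Finset.mem_univ i))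

theorem norm_le_l2Norm (x : n → ℝ) : ‖x‖ ≤ l2Norm x :=
  (pi_norm_le_iff_of_nonneg (Real.sqrt_nonneg _)).2 fun i => abs_apply_le_l2Norm x i

theorem l2Norm_nonneg (x : n → ℝ) : 0 ≤ l2Norm x := Real.sqrt_nonneg _

theorem measurable_l2Norm : Measurable (l2Norm : (n → ℝ) → ℝ) := by
  unfold l2Norm
  fun_prop

theorem spectralNorm_nonneg [DecidableEq n] (A : Matrix m n ℝ) : 0 ≤ spectralNorm A :=
  norm_nonneg _

theorem abs_apply_le_spectralNorm [DecidableEq n] (A : Matrix m n ℝ) (i : m) (j : n) :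
    |A i j| ≤ spectralNorm A := by
  have h1 := (LinearMap.toContinuousLinearMap (Matrix.toEuclideanLin A)).le_opNorm
    (EuclideanSpace.single j (1 : ℝ))
  have h2 := PiLp.norm_apply_le
    ((LinearMap.toContinuousLinearMap (Matrix.toEuclideanLin A)) (EuclideanSpace.single j (1 : ℝ))) i
  have h3 : ((LinearMap.toContinuousLinearMap (Matrix.toEuclideanLin A))
      (EuclideanSpace.single j (1 : ℝ))) i = A i j := by
    simp
  rw [h3] at h2
  rw [PiLp.norm_single, norm_one, mul_one] at h1
  exact h2.trans h1

theorem abs_apply_le_maxRowNorm (A : Matrix m n ℝ) (i : m) (j : n) : |A i j| ≤ maxRowNorm A :=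
  (abs_apply_le_l2Norm (A i) j).trans
    (le_ciSup (f := fun i => l2Norm (A i)) (Set.finite_range _).bddAbove i)

end Norms

/-! ### Discretization of matrices of bounded rank. -/

section Factorization

variable {U d : ℕ}

/-- A matrix of rank at most `r` with entries in `[-1, 1]` is `U • P * Q` with `P`, `Q` of inner
dimension `r` and entries in `[-1, 1]`. -/
theorem exists_factorization (A : Matrix (Fin U) (Fin d) ℝ) {r : ℕ} (hr : A.rank ≤ r)
    (hA : ∀ i j, |A i j| ≤ 1) :
    ∃ (P : Matrix (Fin U) (Fin r) ℝ) (Q : Matrix (Fin r) (Fin d) ℝ),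
      (∀ i k, |P i k| ≤ 1) ∧ (∀ k j, |Q k j| ≤ 1) ∧
        ∀ i j, A i j = U * ∑ k, P i k * Q k j := by
  -- The surplus `t` of `r` over the rank is filled with zero columns of `P` and zero rows of `Q`.
  obtain ⟨t, rfl⟩ := Nat.exists_eq_add_of_le hr
  let V : Submodule ℝ (EuclideanSpace ℝ (Fin U)) := LinearMap.range (Matrix.toEuclideanLin A)
  have hV : Module.finrank ℝ V = A.rank := by
    rw [A.rank_eq_finrank_range_toLin (PiLp.basisFun 2 ℝ _) (PiLp.basisFun 2 ℝ _)]
    rfl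
  let e : OrthonormalBasis (Fin A.rank) ℝ V := (stdOrthonormalBasis ℝ V).reindex (finCongr hV)
  have he : ∀ k i, |(e k : EuclideanSpace ℝ (Fin U)) i| ≤ 1 := fun k i => by
    have h1 := PiLp.norm_apply_le (e k : EuclideanSpace ℝ (Fin U)) i
    have h2 : ‖(e k : EuclideanSpace ℝ (Fin U))‖ = 1 := by
      exact e.orthonormal.1 k
    rwa [h2] at h1
  have hcol : ∀ i j, A i j = ∑ k, (e k : EuclideanSpace ℝ (Fin U)) i *
      ∑ i', (e k : EuclideanSpace ℝ (Fin U)) i' * A i' j := fun i j => by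
    let v : V := ⟨Matrix.toEuclideanLin A (EuclideanSpace.single j (1 : ℝ)), ⟨_, rfl⟩⟩
    have hv : ∀ i, (v : EuclideanSpace ℝ (Fin U)) i = A i j := fun i => by
      simp [v]
    have h := congrArg (fun w : V => (w : EuclideanSpace ℝ (Fin U)) i) (e.sum_repr' v)
    simp only [hv, Submodule.coe_inner] at h
    rw [← h]
    simp [PiLp.inner_apply, hv, mul_comm]
  -- `P` holds an orthonormal basis of the column space. The coefficients of a column of `A` in it
  -- are sums of `U` terms of size at most 1, hence the division by `U`.
  refine ⟨fun i => Fin.append (fun k => (e k : EuclideanSpace ℝ (Fin U)) i) 0,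
    Fin.append (fun k j => (∑ i, (e k : EuclideanSpace ℝ (Fin U)) i * A i j) / U) 0, ?_, ?_, ?_⟩
  · intro i k
    refine Fin.addCases (fun k => ?_) (fun k => ?_) k
    · simpa using he k i
    · simp
  · intro k j
    refine Fin.addCases (fun k => ?_) (fun k => ?_) k
    · rw [Fin.append_left, abs_div, Nat.abs_cast]
      refine div_le_one_of_le₀ ?_ (Nat.cast_nonneg _)
      refine (Finset.abs_sum_le_sum_abs _ _).trans ?_
      refine (Finset.sum_le_card_nsmul _ _ 1 fun i _ => ?_).trans (by simp)
      rw [abs_mul]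
      exact mul_le_one₀ (he k i) (abs_nonneg _) (hA i j)
    · simp
  · intro i j
    have hU : (U : ℝ) ≠ 0 := Nat.cast_ne_zero.2 i.pos.ne'
    rw [Fin.sum_univ_add]
    simp only [Fin.append_left, Fin.append_right, Pi.zero_apply, zero_mul, Finset.sum_const_zero,
      add_zero, Finset.mul_sum]
    rw [hcol i j]
    refine Finset.sum_congr rfl fun k _ => ?_
    field_simp

/-- The grid of the points `k / m`, `-m ≤ k ≤ m`. -/
noncomputable def gridPoint (m : ℕ) (k : Fin (2 * m + 1)) : ℝ := ((k : ℝ) - m) / m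

theorem abs_gridPoint_le (m : ℕ) (k : Fin (2 * m + 1)) : |gridPoint m k| ≤ 1 := by
  rw [gridPoint, abs_div, Nat.abs_cast]
  refine div_le_one_of_le₀ ?_ (Nat.cast_nonneg _)
  have h : (k : ℝ) ≤ 2 * m := by exact_mod_cast Nat.lt_succ_iff.1 k.2
  rw [abs_le]
  constructor <;> linarith [(Nat.cast_nonneg k : (0 : ℝ) ≤ (k : ℕ))]

theorem exists_gridPoint_near {m : ℕ} (hm : 0 < m) {t : ℝ} (ht : |t| ≤ 1) :
    ∃ k, |t - gridPoint m k| ≤ 1 / m := by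
  have hm' : (0 : ℝ) < m := Nat.cast_pos.2 hm
  obtain ⟨h1, h2⟩ := abs_le.1 ht
  have h3 : 0 ≤ (t + 1) * m := mul_nonneg (by linarith) hm'.le
  have h4 : ⌊(t + 1) * m⌋₊ < 2 * m + 1 := by
    rw [Nat.lt_succ_iff]
    refine Nat.floor_le_of_le ?_
    push_cast
    nlinarith
  refine ⟨⟨_, h4⟩, ?_⟩
  have h5 := Nat.floor_le h3
  have h6 := Nat.lt_floor_add_one ((t + 1) * m)
  have h7 : t - gridPoint m ⟨_, h4⟩ = ((t + 1) * m - (⌊(t + 1) * m⌋₊ : ℝ)) / m := by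
    rw [gridPoint]
    field_simp
    ring
  rw [h7, abs_div, abs_of_pos hm']
  gcongr
  rw [abs_le]
  constructor <;> linarith

/-- The matrix `s U • P * Q` with factors `P`, `Q` whose entries are grid points. -/
noncomputable def gridMatrix (s : ℝ) {r : ℕ} (m : ℕ)
    (k : Fin U × Fin r ⊕ Fin r × Fin d → Fin (2 * m + 1)) : Matrix (Fin U) (Fin d) ℝ :=
  Matrix.of fun i j =>
    s * (U * ∑ l, gridPoint m (k (.inl (i, l))) * gridPoint m (k (.inr (l, j))))

/-- Factorize `A / s` and round both factors. Each product of two entries moves by at most `2 / m`;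
there are `r` of them in the sum, with prefactor `s U`. The case `s = 0` forces `A = 0` and is
consistent with `s⁻¹ = 0`. -/
theorem exists_gridMatrix_near {s : ℝ} (hs : 0 ≤ s) {r m : ℕ} (hm : 0 < m)
    (A : Matrix (Fin U) (Fin d) ℝ) (hr : A.rank ≤ r) (hA : ∀ i j, |A i j| ≤ s) :
    ∃ k : Fin U × Fin r ⊕ Fin r × Fin d → Fin (2 * m + 1),
      ∀ i j, |A i j - gridMatrix s m k i j| ≤ 2 * U * r / m * s := by
  have hrank : (s⁻¹ • A).rank ≤ r := by
    refine le_trans ?_ hr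
    rw [show s⁻¹ • A = (s⁻¹ • (1 : Matrix (Fin U) (Fin U) ℝ)) * A by simp]
    exact Matrix.rank_mul_le_right _ _
  obtain ⟨P, Q, hP, hQ, hPQ⟩ := exists_factorization (s⁻¹ • A) hrank fun i j => by
    rw [Matrix.smul_apply, smul_eq_mul, abs_mul, abs_inv, abs_of_nonneg hs]
    exact inv_mul_le_one_of_le₀ (hA i j) hs
  choose p hp using fun i l => exists_gridPoint_near hm (hP i l)
  choose q hq using fun l j => exists_gridPoint_near hm (hQ l j)
  refine ⟨Sum.elim (fun x => p x.1 x.2) (fun x => q x.1 x.2), fun i j => ?_⟩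
  have hAs : A i j = s * (U * ∑ l, P i l * Q l j) := by
    rw [← hPQ i j, Matrix.smul_apply, smul_eq_mul]
    rcases hs.eq_or_lt with h | h
    · have := hA i j
      rw [← h] at this
      rw [abs_nonpos_iff.1 this, ← h, zero_mul]
    · field_simp
  have hterm : ∀ l, |P i l * Q l j - gridPoint m (p i l) * gridPoint m (q l j)| ≤ 2 / m := by
    intro l
    have h : P i l * Q l j - gridPoint m (p i l) * gridPoint m (q l j) =
        (P i l - gridPoint m (p i l)) * Q l j + gridPoint m (p i l) * (Q l j - gridPoint m (q l j)) := by
      ring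
    rw [h]
    refine (abs_add_le _ _).trans ?_
    rw [abs_mul, abs_mul]
    have hm1 : (0 : ℝ) ≤ 1 / m := by positivity
    have e1 := mul_le_mul (hp i l) (hQ l j) (abs_nonneg _) hm1
    have e2 := mul_le_mul (abs_gridPoint_le m (p i l)) (hq l j) (abs_nonneg _) zero_le_one
    calc _ ≤ 1 / (m : ℝ) * 1 + 1 * (1 / m) := add_le_add e1 e2
      _ = 2 / m := by ring
  rw [hAs, gridMatrix, Matrix.of_apply, ← mul_sub, ← mul_sub, ← Finset.sum_sub_distrib, abs_mul,
    abs_mul, abs_of_nonneg hs, Nat.abs_cast]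
  have hsum : |∑ l, (P i l * Q l j - gridPoint m (p i l) * gridPoint m (q l j))| ≤ r * (2 / m) := by
    refine (Finset.abs_sum_le_sum_abs _ _).trans ?_
    refine (Finset.sum_le_card_nsmul _ _ _ fun l _ => hterm l).trans (by simp)
  calc _ ≤ s * (U * (r * (2 / m))) := by
        gcongr
        exact hsum
    _ = 2 * U * r / m * s := by ring

end Factorization

/-! ### Perturbation of the network in its filters. -/

namespace Architecture

variable {L : ℕ} (a : Architecture L)

/-- The coordinates of a patch are distinct, so each filter entry occurs unchanged as an entry of
`op(A)`; any patch will do. -/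
theorem abs_apply_le_spectralNorm_convMatrix (ℓ : Fin L)
    (A : Matrix (Fin (a.channels ℓ.succ)) (Fin (a.patchDim ℓ)) ℝ) (j : Fin (a.channels ℓ.succ))
    (i : Fin (a.patchDim ℓ)) : |A j i| ≤ spectralNorm (a.convMatrix ℓ A) := by
  let o : Fin (a.numPatches ℓ) := ⟨0, a.numPatches_pos ℓ⟩
  have h : a.convMatrix ℓ A (j, o) (a.patch ℓ o i) = A j i := by
    simp [convMatrix, (a.patch ℓ o).injective.eq_iff]
  exact h ▸ abs_apply_le_spectralNorm (a.convMatrix ℓ A) (j, o) (a.patch ℓ o i)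

theorem Constrained.abs_apply_le {a : Architecture L} {s : Fin L → ℝ} {r : Fin L → ℕ}
    {A : a.Filters} (h : a.Constrained s r A) (ℓ : Fin L) (j i) : |A ℓ j i| ≤ s ℓ := by
  rcases (Nat.succ_le_iff.2 ℓ.2).lt_or_eq with hℓ | hℓ
  · exact (a.abs_apply_le_spectralNorm_convMatrix ℓ (A ℓ) j i).trans (h.1 ℓ hℓ)
  · exact (abs_apply_le_maxRowNorm (A ℓ) j i).trans (h.2.1 ℓ hℓ)

theorem norm_conv_le (ℓ : Fin L) {A : Matrix (Fin (a.channels ℓ.succ)) (Fin (a.patchDim ℓ)) ℝ}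
    {t : ℝ} (ht : 0 ≤ t) (hA : ∀ j i, |A j i| ≤ t) (x : a.Act ℓ.castSucc) :
    ‖a.conv ℓ A x‖ ≤ a.patchDim ℓ * t * ‖x‖ := by
  refine (pi_norm_le_iff_of_nonneg (by positivity)).2 fun jo => ?_
  refine (norm_sum_le _ _).trans ?_
  refine (Finset.sum_le_card_nsmul _ _ (t * ‖x‖) fun i _ => ?_).trans (by simp [mul_assoc])
  rw [norm_mul, mul_comm t]
  exact mul_le_mul (norm_le_pi_norm x _) (hA _ _) (norm_nonneg _) (norm_nonneg _)

theorem conv_sub_conv (ℓ : Fin L) (A A' : Matrix (Fin (a.channels ℓ.succ)) (Fin (a.patchDim ℓ)) ℝ)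
    (x x' : a.Act ℓ.castSucc) :
    a.conv ℓ A x - a.conv ℓ A' x' = a.conv ℓ A (x - x') + a.conv ℓ (A - A') x' := by
  funext jo
  simp only [conv, Pi.sub_apply, Pi.add_apply, Matrix.sub_apply, ← Finset.sum_sub_distrib,
    ← Finset.sum_add_distrib]
  exact Finset.sum_congr rfl fun i _ => by ring

theorem continuous_conv (ℓ : Fin L)
    (A : Matrix (Fin (a.channels ℓ.succ)) (Fin (a.patchDim ℓ)) ℝ) : Continuous (a.conv ℓ A) := by
  unfold conv
  fun_prop

@[simp]
theorem forward_zero (A : a.Filters) (x : a.Input) : a.forward A x 0 = x := rfl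

theorem forward_succ (A : a.Filters) (x : a.Input) (ℓ : Fin L) :
    a.forward A x ℓ.succ = a.act ℓ (a.conv ℓ (A ℓ) (a.forward A x ℓ.castSucc)) := rfl

theorem continuous_net (A : a.Filters) : Continuous (a.net A) := by
  have h : ∀ k, Continuous fun x => a.forward A x k := fun k => by
    induction k using Fin.induction with
    | zero => exact continuous_id
    | succ ℓ ih =>
      exact (a.act_lipschitz ℓ).continuous.comp ((a.continuous_conv ℓ (A ℓ)).comp ih)
  exact h _

theorem norm_act_le (ℓ : Fin L) (v) : ‖a.act ℓ v‖ ≤ a.rho ℓ * ‖v‖ := by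
  simpa [a.act_zero ℓ] using (a.act_lipschitz ℓ).dist_le_mul v 0

/-- The network vanishes as soon as one of its filters does. -/
theorem net_eq_zero {A : a.Filters} {ℓ : Fin L} (hA : A ℓ = 0) (x : a.Input) : a.net A x = 0 := by
  have hconv : ∀ (k : Fin L) (B : Matrix (Fin (a.channels k.succ)) (Fin (a.patchDim k)) ℝ),
      a.conv k B 0 = 0 := fun k B => by
    funext jo
    simp [conv]
  have h : ∀ k : Fin (L + 1), ℓ.castSucc < k → a.forward A x k = 0 := fun k => by
    induction k using Fin.induction with
    | zero => exact fun h => absurd h (Fin.not_lt_zero _)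
    | succ k ih =>
      intro hk
      rw [forward_succ]
      rcases (Fin.castSucc_lt_succ_iff.1 hk).eq_or_lt with rfl | hlt
      · have : a.conv ℓ (A ℓ) (a.forward A x ℓ.castSucc) = 0 := by
          funext jo
          simp [conv, hA]
        rw [this, a.act_zero]
      · rw [ih (Fin.castSucc_lt_castSucc_iff.2 hlt), hconv, a.act_zero]
  exact h _ (Fin.castSucc_lt_last ℓ)

/-- The Lipschitz constant `ρ_ℓ d_ℓ s_ℓ` of a layer whose filter entries are at most `s_ℓ`. -/
noncomputable def layerLip (s : Fin L → ℝ) (ℓ : Fin L) : ℝ := a.rho ℓ * a.patchDim ℓ * s ℓ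

theorem norm_forward_le {s : Fin L → ℝ} (hs : ∀ ℓ, 0 ≤ s ℓ) {A : a.Filters}
    (hA : ∀ ℓ j i, |A ℓ j i| ≤ s ℓ) (x : a.Input) (k : Fin (L + 1)) :
    ‖a.forward A x k‖ ≤ ‖x‖ * Fin.partialProd (a.layerLip s) k := by
  induction k using Fin.induction with
  | zero => simp
  | succ ℓ ih =>
    have hs' := hs ℓ
    rw [forward_succ, Fin.partialProd_succ]
    calc _ ≤ a.rho ℓ * ‖a.conv ℓ (A ℓ) (a.forward A x ℓ.castSucc)‖ := a.norm_act_le ℓ _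
      _ ≤ a.rho ℓ * (a.patchDim ℓ * s ℓ * (‖x‖ * Fin.partialProd (a.layerLip s) ℓ.castSucc)) := by
        gcongr
        refine (a.norm_conv_le ℓ (hs ℓ) (hA ℓ) _).trans ?_
        gcongr
      _ = _ := by rw [layerLip]; ring

/-- Relative to the size bound of the layer, the error `e_k` obeys `e_{k+1} ≤ (1 + η) e_k + η`: the
old error passes through the perturbed filter, and the filter error acts on the exact activation.
With `η ≤ 1` this gives `e_k ≤ η (2^k - 1)`. -/
theorem norm_forward_sub_le {s : Fin L → ℝ} (hs : ∀ ℓ, 0 ≤ s ℓ) {A A' : a.Filters} {η : ℝ}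
    (hη0 : 0 ≤ η) (hη1 : η ≤ 1) (hA : ∀ ℓ j i, |A ℓ j i| ≤ s ℓ)
    (hAA' : ∀ ℓ j i, |A ℓ j i - A' ℓ j i| ≤ η * s ℓ) (x : a.Input) (k : Fin (L + 1)) :
    ‖a.forward A' x k - a.forward A x k‖ ≤
      η * (2 ^ (k : ℕ) - 1) * (‖x‖ * Fin.partialProd (a.layerLip s) k) := by
  induction k using Fin.induction with
  | zero => simp
  | succ ℓ ih =>
    have hs' := hs ℓ
    have hF := a.norm_forward_le hs hA x ℓ.castSucc
    set H := ‖x‖ * Fin.partialProd (a.layerLip s) ℓ.castSucc with hH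
    have hH0 : 0 ≤ H := (norm_nonneg _).trans hF
    have hA' : ∀ j i, |A' ℓ j i| ≤ (1 + η) * s ℓ := fun j i => by
      have h1 := abs_sub_abs_le_abs_sub (A' ℓ j i) (A ℓ j i)
      rw [abs_sub_comm] at h1
      linarith [hA ℓ j i, hAA' ℓ j i]
    rw [forward_succ, forward_succ, Fin.partialProd_succ, Fin.val_succ, pow_succ]
    rw [Fin.val_castSucc] at ih
    have hc : (1 : ℝ) ≤ 2 ^ (ℓ : ℕ) := one_le_pow₀ one_le_two
    set c : ℝ := 2 ^ (ℓ : ℕ)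
    have h1 : ‖a.conv ℓ (A' ℓ) (a.forward A' x ℓ.castSucc - a.forward A x ℓ.castSucc)‖ ≤
        a.patchDim ℓ * ((1 + η) * s ℓ) * (η * (c - 1) * H) :=
      (a.norm_conv_le ℓ (by positivity) hA' _).trans (by gcongr)
    have h2 : ‖a.conv ℓ (A' ℓ - A ℓ) (a.forward A x ℓ.castSucc)‖ ≤
        a.patchDim ℓ * (η * s ℓ) * H :=
      (a.norm_conv_le ℓ (t := η * s ℓ) (by positivity)
        (fun j i => by rw [Matrix.sub_apply, abs_sub_comm]; exact hAA' ℓ j i) _).trans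
        (by gcongr)
    have h3 := (a.act_lipschitz ℓ).dist_le_mul (a.conv ℓ (A' ℓ) (a.forward A' x ℓ.castSucc))
      (a.conv ℓ (A ℓ) (a.forward A x ℓ.castSucc))
    rw [dist_eq_norm, dist_eq_norm, conv_sub_conv] at h3
    have h4 : (a.rho ℓ : ℝ) * ‖a.conv ℓ (A' ℓ) (a.forward A' x ℓ.castSucc -
        a.forward A x ℓ.castSucc) + a.conv ℓ (A' ℓ - A ℓ) (a.forward A x ℓ.castSucc)‖ ≤
        a.rho ℓ * (a.patchDim ℓ * ((1 + η) * s ℓ) * (η * (c - 1) * H) +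
          a.patchDim ℓ * (η * s ℓ) * H) := by
      gcongr
      exact (norm_add_le _ _).trans (add_le_add h1 h2)
    refine (h3.trans h4).trans ?_
    have h5 : 0 ≤ a.rho ℓ * a.patchDim ℓ * s ℓ * (η * H) := by positivity
    have h6 : (1 + η) * (c - 1) + 1 ≤ c * 2 - 1 := by nlinarith
    calc _ = a.rho ℓ * a.patchDim ℓ * s ℓ * (η * H) * ((1 + η) * (c - 1) + 1) := by ring
      _ ≤ a.rho ℓ * a.patchDim ℓ * s ℓ * (η * H) * (c * 2 - 1) := by gcongr
      _ = _ := by rw [hH, layerLip]; ring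

theorem norm_net_sub_le {s : Fin L → ℝ} (hs : ∀ ℓ, 0 ≤ s ℓ) {A A' : a.Filters} {η : ℝ}
    (hη0 : 0 ≤ η) (hη1 : η ≤ 1) (hA : ∀ ℓ j i, |A ℓ j i| ≤ s ℓ)
    (hAA' : ∀ ℓ j i, |A ℓ j i - A' ℓ j i| ≤ η * s ℓ) (x : a.Input) :
    ‖a.net A' x - a.net A x‖ ≤ η * 2 ^ L * (‖x‖ * ∏ ℓ, a.layerLip s ℓ) := by
  have h := a.norm_forward_sub_le hs hη0 hη1 hA hAA' x (Fin.last L)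
  have hP : Fin.partialProd (a.layerLip s) (Fin.last L) = ∏ ℓ, a.layerLip s ℓ := by
    rw [Fin.partialProd, ← List.prod_ofFn]
    congr 1
    exact List.take_of_length_le (by simp)
  rw [hP, Fin.val_last] at h
  refine h.trans ?_
  have : 0 ≤ ∏ ℓ, a.layerLip s ℓ :=
    Finset.prod_nonneg fun ℓ _ => by have := hs ℓ; unfold layerLip; positivity
  gcongr
  linarith

end Architecture

/-! ### Union bounds, Hoeffding's inequality and a tail level. -/

section Concentration

/-- A union bound over `ℕ × ι` with weights that are geometric on `ℕ` and uniform on `ι`. -/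
theorem measure_iUnion_le_of_geometric {Ω ι : Type*} [MeasurableSpace Ω] (μ : Measure Ω)
    [Fintype ι] [Nonempty ι] {δ : ℝ} (hδ : 0 ≤ δ) {E : ℕ → ι → Set Ω}
    (hE : ∀ n i, μ (E n i) ≤ ENNReal.ofReal (δ / 2 / 2 ^ n / Fintype.card ι)) :
    μ (⋃ n, ⋃ i, E n i) ≤ ENNReal.ofReal δ := by
  have hcard : (0 : ℝ) < Fintype.card ι := by exact_mod_cast Fintype.card_pos
  calc _ ≤ ∑' n, μ (⋃ i, E n i) := measure_iUnion_le _
    _ ≤ ∑' n : ℕ, ENNReal.ofReal (δ / 2 / 2 ^ n) := by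
      refine ENNReal.tsum_le_tsum fun n => (measure_iUnion_fintype_le _ _).trans ?_
      refine (Finset.sum_le_sum fun i _ => hE n i).trans_eq ?_
      rw [Finset.sum_const, ← ENNReal.ofReal_nsmul, Finset.card_univ, nsmul_eq_mul]
      congr 1
      field_simp
    _ = ENNReal.ofReal δ := by
      rw [← ENNReal.ofReal_tsum_of_nonneg (fun n => by positivity) (summable_geometric_two' δ),
        tsum_geometric_two']

variable {Z : Type*} [MeasurableSpace Z] (D : Measure Z) [IsProbabilityMeasure D]

/-- The gap is expectation minus average, so it is an upper deviation of `-f`, whose values lie in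
an interval of length `M`; centred, it is sub-Gaussian with parameter `(M/2)²`. -/
theorem measure_gap_ge_le {N : ℕ} (hN : 0 < N) {f : Z → ℝ} (hf : Measurable f) {M : ℝ}
    (hM : 0 < M) (h0 : ∀ z, 0 ≤ f z) (h1 : ∀ z, f z ≤ M) {t : ℝ} (ht : 0 ≤ t) :
    Measure.pi (fun _ : Fin N => D)
      {z | t ≤ (∫ q, f q ∂D) - (1 / (N : ℝ)) * ∑ i, f (z i)} ≤
        ENNReal.ofReal (Real.exp (-(2 * N * t ^ 2 / M ^ 2))) := by
  have hN' : (0 : ℝ) < N := Nat.cast_pos.2 hN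
  let g : Z → ℝ := fun q => -f q
  have hg : Measurable g := hf.neg
  have hsub : ProbabilityTheory.HasSubgaussianMGF (fun q => g q - ∫ q, g q ∂D)
      ((‖(0 : ℝ) - (-M)‖₊ / 2) ^ 2) D :=
    ProbabilityTheory.hasSubgaussianMGF_of_mem_Icc hg.aemeasurable
      (ae_of_all _ fun q => ⟨neg_le_neg (h1 q), neg_nonpos.2 (h0 q)⟩)
  have hX : Measurable fun q => g q - ∫ q, g q ∂D := hg.sub_const _
  have hind : ProbabilityTheory.iIndepFun (fun (i : Fin N) (z : Fin N → Z) => g (z i) - ∫ q, g q ∂D)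
      (Measure.pi fun _ : Fin N => D) :=
    ProbabilityTheory.iIndepFun_pi (μ := fun _ : Fin N => D)
      (X := fun _ q => g q - ∫ q, g q ∂D) fun i => hX.aemeasurable
  have hsubi : ∀ i ∈ (Finset.univ : Finset (Fin N)),
      ProbabilityTheory.HasSubgaussianMGF (fun z : Fin N → Z => g (z i) - ∫ q, g q ∂D)
        ((‖(0 : ℝ) - (-M)‖₊ / 2) ^ 2) (Measure.pi fun _ : Fin N => D) := fun i _ => by
    have hmp := measurePreserving_eval (fun _ : Fin N => D) i
    refine ProbabilityTheory.HasSubgaussianMGF.of_map (X := fun q => g q - ∫ q, g q ∂D)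
      (Y := fun z : Fin N → Z => z i) (measurable_pi_apply i).aemeasurable ?_
    rw [show (fun z : Fin N → Z => z i) = Function.eval i from rfl, hmp.map_eq]
    exact hsub
  have h := ProbabilityTheory.HasSubgaussianMGF.measure_sum_ge_le_of_iIndepFun hind hsubi
    (mul_nonneg hN'.le ht)
  have hset : {z : Fin N → Z | t ≤ (∫ q, f q ∂D) - (1 / (N : ℝ)) * ∑ i, f (z i)} =
      {z | N * t ≤ ∑ i, (g (z i) - ∫ q, g q ∂D)} := by
    ext z
    have e : ∑ i, (g (z i) - ∫ q, g q ∂D) =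
        N * ((∫ q, f q ∂D) - (1 / (N : ℝ)) * ∑ i, f (z i)) := by
      simp only [g, integral_neg, sub_neg_eq_add, Finset.sum_add_distrib, Finset.sum_neg_distrib,
        Finset.sum_const, Finset.card_univ, Fintype.card_fin, nsmul_eq_mul]
      field_simp
      ring
    rw [Set.mem_ofPred_eq, Set.mem_ofPred_eq, e, mul_le_mul_iff_right₀ hN']
  rw [hset, ← ofReal_measureReal]
  refine ENNReal.ofReal_le_ofReal (h.trans_eq ?_)
  congr 1
  have hM2 : ((‖(0 : ℝ) - (-M)‖₊ : ℝ≥0) : ℝ) = M := by simp [abs_of_pos hM]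
  simp only [Finset.sum_const, Finset.card_univ, Fintype.card_fin, nsmul_eq_mul]
  push_cast
  simp only [coe_nnnorm] at hM2 ⊢
  rw [hM2]
  field_simp

/-- Hoeffding's inequality with a union bound over a finite class of functions. -/
theorem measure_exists_gap_gt_le {N : ℕ} (hN : 0 < N) {ι : Type*} [Fintype ι] [Nonempty ι]
    {f : ι → Z → ℝ} (hf : ∀ j, Measurable (f j)) {M : ℝ} (h0 : ∀ j z, 0 ≤ f j z)
    (h1 : ∀ j z, f j z ≤ M) {δ : ℝ} (hδ0 : 0 < δ) (hδ1 : δ ≤ 1) :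
    Measure.pi (fun _ : Fin N => D)
      {z | ∃ j, M * √(Real.log (Fintype.card ι / δ) / (2 * N)) <
        (∫ q, f j q ∂D) - (1 / (N : ℝ)) * ∑ i, f j (z i)} ≤ ENNReal.ofReal δ := by
  have hN' : (0 : ℝ) < N := Nat.cast_pos.2 hN
  have hcard : (1 : ℝ) ≤ Fintype.card ι := by exact_mod_cast Fintype.card_pos
  obtain ⟨q₀⟩ : Nonempty Z := nonempty_of_isProbabilityMeasure D
  obtain ⟨j₀⟩ := ‹Nonempty ι›
  -- For `M = 0` the Hoeffding exponent would divide by zero, but then all functions vanish.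
  rcases ((h0 j₀ q₀).trans (h1 j₀ q₀)).eq_or_lt with rfl | hM
  · have hz : ∀ j, f j = 0 := fun j => funext fun q => le_antisymm (h1 j q) (h0 j q)
    simp [hz]
  set t := M * √(Real.log (Fintype.card ι / δ) / (2 * N)) with ht
  have hlog : 0 ≤ Real.log (Fintype.card ι / δ) :=
    Real.log_nonneg ((one_le_div hδ0).2 (hδ1.trans hcard))
  have hexp : Real.exp (-(2 * N * t ^ 2 / M ^ 2)) = δ / Fintype.card ι := by
    have : 2 * N * t ^ 2 / M ^ 2 = Real.log (Fintype.card ι / δ) := by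
      rw [ht, mul_pow, Real.sq_sqrt (by positivity)]
      field_simp
    rw [this, Real.exp_neg, Real.exp_log (by positivity), inv_div]
  calc _ ≤ ∑ j, Measure.pi (fun _ : Fin N => D)
        {z | t ≤ (∫ q, f j q ∂D) - (1 / (N : ℝ)) * ∑ i, f j (z i)} := by
        refine le_trans (measure_mono ?_) (measure_iUnion_fintype_le _ _)
        rintro z ⟨j, hj⟩
        exact Set.mem_iUnion.2 ⟨j, hj.le⟩
    _ ≤ ∑ _j : ι, ENNReal.ofReal (δ / Fintype.card ι) :=
        Finset.sum_le_sum fun j _ => hexp ▸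
          measure_gap_ge_le D hN (hf j) hM (h0 j) (h1 j) (by positivity)
    _ = ENNReal.ofReal δ := by
        rw [Finset.sum_const, ← ENNReal.ofReal_nsmul, Finset.card_univ, nsmul_eq_mul]
        congr 1
        field_simp

/-- If `ρ` is measurable, then for some natural number `K` the tail `D {K < ρ}` is at most `ε`,
while all of `N` independent samples satisfy `ρ + 1 < K` with probability at most `exp (-ε N)`. -/
theorem exists_tail_level {ρ : Z → ℝ} (hρ : Measurable ρ) (hρ0 : ∀ z, 0 ≤ ρ z) (N : ℕ) {ε : ℝ}
    (hε : 0 < ε) :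
    ∃ K : ℕ, D.real {q | (K : ℝ) < ρ q} ≤ ε ∧
      Measure.pi (fun _ : Fin N => D) {z | ∀ i, ρ (z i) + 1 < K} ≤
        ENNReal.ofReal (Real.exp (-(ε * N))) := by
  classical
  have hex : ∃ K : ℕ, D.real {q | (K : ℝ) < ρ q} ≤ ε := by
    have hanti : Antitone fun K : ℕ => {q | (K : ℝ) < ρ q} := fun K K' h q hq =>
      lt_of_le_of_lt (Nat.cast_le.2 h) hq.out
    have hlim := tendsto_measure_iInter_atTop (μ := D)
      (fun K : ℕ => (measurableSet_lt measurable_const hρ).nullMeasurableSet) hanti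
      ⟨0, measure_ne_top _ _⟩
    have hempty : ⋂ K : ℕ, {q | (K : ℝ) < ρ q} = ∅ := by
      refine Set.eq_empty_iff_forall_notMem.2 fun q hq => ?_
      obtain ⟨K, hK⟩ := exists_nat_ge (ρ q)
      exact absurd (Set.mem_iInter.1 hq K) (not_lt.2 hK)
    rw [hempty, measure_empty] at hlim
    obtain ⟨K, hK⟩ := (hlim.eventually (gt_mem_nhds (ENNReal.ofReal_pos.2 hε))).exists
    exact ⟨K, ENNReal.toReal_le_of_le_ofReal hε.le hK.le⟩
  -- Take `K` minimal. If `K > 0`, the tail beyond `K - 1` exceeds `ε`, so one sample stays below `K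
  -- - 1` with probability at most `1 - ε ≤ exp (-ε)`. If `K = 0`, the event is empty unless there
  -- are no samples.
  refine ⟨Nat.find hex, Nat.find_spec hex, ?_⟩
  rcases hK : Nat.find hex with _ | K
  · rcases Nat.eq_zero_or_pos N with rfl | hN
    · simp
    · have : {z : Fin N → Z | ∀ i, ρ (z i) + 1 < ((0 : ℕ) : ℝ)} = ∅ :=
        Set.eq_empty_iff_forall_notMem.2 fun z hz => by
          have := hz ⟨0, hN⟩
          have := hρ0 (z ⟨0, hN⟩)
          push_cast at *
          linarith
      rw [this, measure_empty]
      exact zero_le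
  · have hK' : ε < D.real {q | (K : ℝ) < ρ q} :=
      not_le.1 (Nat.find_min hex (hK ▸ Nat.lt_succ_self K))
    have hE : {z : Fin N → Z | ∀ i, ρ (z i) + 1 < ((K + 1 : ℕ) : ℝ)} =
        Set.univ.pi fun _ => {q | ρ q < K} := by
      ext z
      simp
    have hle : D.real {q | ρ q < K} ≤ Real.exp (-ε) := by
      have h1 : D.real {q | ρ q < K} ≤ D.real {q | (K : ℝ) < ρ q}ᶜ :=
        measureReal_mono fun q hq => show ¬ _ from not_lt.2 (le_of_lt hq.out)
      rw [probReal_compl_eq_one_sub (measurableSet_lt measurable_const hρ)] at h1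
      linarith [Real.add_one_le_exp (-ε)]
    rw [hE, Measure.pi_pi, Finset.prod_const, Finset.card_univ, Fintype.card_fin,
      ← ofReal_measureReal, ← ENNReal.ofReal_pow measureReal_nonneg]
    refine ENNReal.ofReal_le_ofReal ?_
    calc _ ≤ Real.exp (-ε) ^ N := by gcongr
      _ = _ := by rw [← Real.exp_nat_mul]; ring_nf

end Concentration

namespace Architecture

variable {L : ℕ} (a : Architecture L)

/-! ### Elementary size comparisons. -/

section Sizes

theorem patchDim_mul_channels_le_numParams (ℓ : Fin L) :
    a.patchDim ℓ * a.channels ℓ.succ ≤ a.numParams :=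
  Finset.single_le_sum (f := fun ℓ : Fin L => a.patchDim ℓ * a.channels ℓ.succ)
    (fun _ _ => Nat.zero_le _) (Finset.mem_univ ℓ)

theorem channels_le_numParams (ℓ : Fin L) : a.channels ℓ.succ ≤ a.numParams :=
  (Nat.le_mul_of_pos_left _ (a.patchDim_pos ℓ)).trans (a.patchDim_mul_channels_le_numParams ℓ)

theorem patchDim_le_numParams (ℓ : Fin L) : a.patchDim ℓ ≤ a.numParams :=
  (Nat.le_mul_of_pos_right _ (a.channels_pos ℓ.succ)).trans
    (a.patchDim_mul_channels_le_numParams ℓ)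

theorem one_le_numParams (hL : 0 < L) : 1 ≤ a.numParams :=
  (a.patchDim_pos ⟨0, hL⟩).trans_le (a.patchDim_le_numParams _)

theorem one_le_numPreacts : 1 ≤ a.numPreacts :=
  (Nat.mul_pos (a.channels_pos 0) (a.spatial_pos 0)).trans_le (Nat.le_add_right _ _)

theorem lowRankCount_mono {r r' : Fin L → ℕ} (h : ∀ ℓ, r ℓ ≤ r' ℓ) :
    a.lowRankCount r ≤ a.lowRankCount r' :=
  Finset.sum_le_sum fun ℓ _ => Nat.mul_le_mul_left _ (h ℓ)

/-- Lets factors of `L` be absorbed into the parameter count. -/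
theorem two_mul_le_lowRankCount {r : Fin L → ℕ} (h : ∀ ℓ, 1 ≤ r ℓ) :
    2 * L ≤ a.lowRankCount r := by
  have := Finset.sum_le_sum (s := Finset.univ) (f := fun _ : Fin L => 2)
    (g := fun ℓ : Fin L => (a.channels ℓ.succ + a.patchDim ℓ) * r ℓ) fun ℓ _ => by
      nlinarith [a.channels_pos ℓ.succ, a.patchDim_pos ℓ, h ℓ]
  simpa [mul_comm, lowRankCount] using this

end Sizes

/-! ### Losses clipped outside a ball. -/

section Loss

variable {Y : Type*} (loss : a.Output → Y → ℝ)

/-- The loss of the network with filters `A`, set to zero on the inputs of norm above `b`. -/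
noncomputable def clippedLoss (b : ℝ) (A : a.Filters) : a.Input × Y → ℝ :=
  {q | l2Norm q.1 ≤ b}.indicator fun q => loss (a.net A q.1) q.2

variable {loss} {M : ℝ}

theorem clippedLoss_nonneg (h0 : ∀ v y, 0 ≤ loss v y) (b : ℝ) (A : a.Filters) (q) :
    0 ≤ a.clippedLoss loss b A q :=
  Set.indicator_nonneg (fun _ _ => h0 _ _) q

theorem clippedLoss_le (hM : 0 ≤ M) (h1 : ∀ v y, loss v y ≤ M) (b : ℝ) (A : a.Filters) (q) :
    a.clippedLoss loss b A q ≤ M :=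
  Set.indicator_apply_le' (fun _ => h1 _ _) fun _ => hM

variable [MeasurableSpace Y]

theorem measurable_loss_net (hloss : Measurable (Function.uncurry loss)) (A : a.Filters) :
    Measurable fun q : a.Input × Y => loss (a.net A q.1) q.2 :=
  hloss.comp (((a.continuous_net A).measurable.comp measurable_fst).prodMk measurable_snd)

theorem measurableSet_l2Norm_le (b : ℝ) : MeasurableSet {q : a.Input × Y | l2Norm q.1 ≤ b} :=
  measurableSet_le (measurable_l2Norm.comp measurable_fst) measurable_const

theorem measurable_clippedLoss (hloss : Measurable (Function.uncurry loss)) (b : ℝ)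
    (A : a.Filters) : Measurable (a.clippedLoss loss b A) :=
  (a.measurable_loss_net hloss A).indicator (a.measurableSet_l2Norm_le b)

/-- Clipping costs something only in the expectation, where the lost mass is weighted by `M`; the
empirical mean enters with a minus sign and clipping can only decrease it. The error `e` is paid
once in each of the two. -/
theorem gap_le_of_near (hloss : Measurable (Function.uncurry loss)) (h0 : ∀ v y, 0 ≤ loss v y)
    (h1 : ∀ v y, loss v y ≤ M) (hM : 0 ≤ M) (D : Measure (a.Input × Y)) [IsProbabilityMeasure D]
    {N : ℕ} (hN : 0 < N) {b e : ℝ} (he0 : 0 ≤ e) {A A' : a.Filters}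
    (he : ∀ q : a.Input × Y, l2Norm q.1 ≤ b →
      |loss (a.net A q.1) q.2 - loss (a.net A' q.1) q.2| ≤ e) (z : Fin N → a.Input × Y) :
    a.gap loss D z A ≤ ((∫ q, a.clippedLoss loss b A' q ∂D) -
      (1 / (N : ℝ)) * ∑ i, a.clippedLoss loss b A' (z i)) +
        2 * e + M * D.real {q | b < l2Norm q.1} := by
  have hN' : (0 : ℝ) < N := Nat.cast_pos.2 hN
  have hcompl : {q : a.Input × Y | b < l2Norm q.1} = {q | l2Norm q.1 ≤ b}ᶜ := by
    ext q
    simp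
  have hmeas : MeasurableSet {q : a.Input × Y | b < l2Norm q.1} :=
    hcompl ▸ (a.measurableSet_l2Norm_le b).compl
  have hup : ∀ q : a.Input × Y, loss (a.net A q.1) q.2 ≤ a.clippedLoss loss b A' q + e +
      {q : a.Input × Y | b < l2Norm q.1}.indicator (fun _ => M) q := fun q => by
    by_cases hq : l2Norm q.1 ≤ b
    · rw [clippedLoss, Set.indicator_of_mem (show q ∈ {q : a.Input × Y | l2Norm q.1 ≤ b} from hq),
        Set.indicator_of_notMem (show q ∉ {q : a.Input × Y | b < l2Norm q.1} from not_lt.2 hq)]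
      linarith [(abs_le.1 (he q hq)).2]
    · rw [clippedLoss, Set.indicator_of_notMem
        (show q ∉ {q : a.Input × Y | l2Norm q.1 ≤ b} from hq), Set.indicator_of_mem
        (show q ∈ {q : a.Input × Y | b < l2Norm q.1} from not_le.1 hq)]
      linarith [h1 (a.net A q.1) q.2]
  have hlow : ∀ q : a.Input × Y, a.clippedLoss loss b A' q - e ≤ loss (a.net A q.1) q.2 :=
    fun q => by
    by_cases hq : l2Norm q.1 ≤ b
    · rw [clippedLoss, Set.indicator_of_mem (show q ∈ {q : a.Input × Y | l2Norm q.1 ≤ b} from hq)]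
      linarith [(abs_le.1 (he q hq)).1]
    · rw [clippedLoss, Set.indicator_of_notMem
        (show q ∉ {q : a.Input × Y | l2Norm q.1 ≤ b} from hq)]
      linarith [h0 (a.net A q.1) q.2]
  have hint : Integrable (fun q : a.Input × Y => loss (a.net A q.1) q.2) D :=
    Integrable.of_mem_Icc 0 M (a.measurable_loss_net hloss A).aemeasurable
      (ae_of_all _ fun q => ⟨h0 _ _, h1 _ _⟩)
  have hint' : Integrable (a.clippedLoss loss b A') D :=
    Integrable.of_mem_Icc 0 M (a.measurable_clippedLoss hloss b A').aemeasurable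
      (ae_of_all _ fun q => ⟨a.clippedLoss_nonneg h0 b A' q, a.clippedLoss_le hM h1 b A' q⟩)
  have hind : Integrable ({q : a.Input × Y | b < l2Norm q.1}.indicator fun _ => M) D :=
    (integrable_const M).indicator hmeas
  have hI : (∫ q, loss (a.net A q.1) q.2 ∂D) ≤
      (∫ q, a.clippedLoss loss b A' q ∂D) + e + M * D.real {q | b < l2Norm q.1} := by
    refine (integral_mono hint ((hint'.add (integrable_const e)).add hind) hup).trans_eq ?_
    rw [integral_add' (hint'.add (integrable_const e)) hind,
      integral_add' hint' (integrable_const e), integral_indicator_const _ hmeas]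
    simp [mul_comm]
  have hS : (1 / (N : ℝ)) * ∑ i, a.clippedLoss loss b A' (z i) - e ≤
      (1 / (N : ℝ)) * ∑ i, loss (a.net A (z i).1) (z i).2 := by
    have := Finset.sum_le_sum (s := Finset.univ) fun (i : Fin N) _ => hlow (z i)
    rw [Finset.sum_sub_distrib, Finset.sum_const, Finset.card_univ, Fintype.card_fin,
      nsmul_eq_mul] at this
    have := mul_le_mul_of_nonneg_left this (one_div_pos.2 hN').le
    rw [mul_sub, ← mul_assoc (1 / (N : ℝ)) (N : ℝ), one_div_mul_cancel hN'.ne', one_mul] at this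
    exact this
  rw [gap]
  linarith

end Loss

/-! ### The finite net of networks and the uniform deviation bound. -/

section Net

/-- The index set of a finite set of filters of ranks at most `r`. -/
abbrev GridIndex (r : Fin L → ℕ) (m : ℕ) : Type :=
  ∀ ℓ : Fin L, Fin (a.channels ℓ.succ) × Fin (r ℓ) ⊕ Fin (r ℓ) × Fin (a.patchDim ℓ) →
    Fin (2 * m + 1)

theorem card_gridIndex (r : Fin L → ℕ) (m : ℕ) :
    Fintype.card (a.GridIndex r m) = (2 * m + 1) ^ a.lowRankCount r := by
  simp only [Fintype.card_pi, Fintype.card_fin, Finset.prod_const, Finset.card_univ,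
    Fintype.card_sum, Fintype.card_prod, Finset.prod_pow_eq_pow_sum, lowRankCount]
  congr 1
  exact Finset.sum_congr rfl fun ℓ _ => by ring

/-- The filters indexed by `GridIndex`. -/
noncomputable def gridFilters (s : Fin L → ℝ) {r : Fin L → ℕ} {m : ℕ} (k : a.GridIndex r m) :
    a.Filters := fun ℓ => gridMatrix (s ℓ) m (k ℓ)

variable (lip : ℝ≥0) {N : ℕ} {b : ℝ} {s : Fin L → ℝ}

theorem one_le_prod_rho (hs : ∀ ℓ, 0 ≤ s ℓ) : (1 : ℝ) ≤ ∏ ℓ, ((a.rho ℓ + 1) * s ℓ + 1) := by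
  refine Finset.one_le_prod fun ℓ _ => ?_
  have := hs ℓ
  exact le_add_of_nonneg_left (by positivity)

theorem one_le_gammaFixed (hL : 0 < L) (hN : 0 < N) (hb : 0 ≤ b) (hs : ∀ ℓ, 0 ≤ s ℓ) :
    1 ≤ a.gammaFixed lip N b s := by
  have hP := a.one_le_prod_rho hs
  have hW : (1 : ℝ) ≤ a.numParams := by exact_mod_cast a.one_le_numParams hL
  have hA : (1 : ℝ) ≤ a.numPreacts := by exact_mod_cast a.one_le_numPreacts
  have hN' : (1 : ℝ) ≤ N := by exact_mod_cast hN
  have h1 : (1 : ℝ) ≤ b + 1 := by linarith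
  have h2 : (1 : ℝ) ≤ L * lip + 1 := le_add_of_nonneg_left (by positivity)
  unfold gammaFixed
  exact one_le_mul_of_one_le_of_one_le (one_le_mul_of_one_le_of_one_le
    (one_le_mul_of_one_le_of_one_le (one_le_mul_of_one_le_of_one_le
    (one_le_mul_of_one_le_of_one_le h1 h2) hW) hA) hN') hP

theorem numParams_le_gammaFixed (hN : 0 < N) (hb : 0 ≤ b) (hs : ∀ ℓ, 0 ≤ s ℓ) :
    (a.numParams : ℝ) ≤ a.gammaFixed lip N b s := by
  have hP := a.one_le_prod_rho hs
  have hA : (1 : ℝ) ≤ a.numPreacts := by exact_mod_cast a.one_le_numPreacts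
  have hN' : (1 : ℝ) ≤ N := by exact_mod_cast hN
  have h1 : (1 : ℝ) ≤ b + 1 := by linarith
  have h2 : (1 : ℝ) ≤ L * lip + 1 := le_add_of_nonneg_left (by positivity)
  unfold gammaFixed
  calc (a.numParams : ℝ) = 1 * 1 * a.numParams * 1 * 1 * 1 := by ring
    _ ≤ _ := by gcongr

/-- Controls the loss perturbation by `Γ`. The factor `𝒲^L` pays for the patch sizes `d_ℓ` in the
sup-norm estimates of the convolutions. -/
theorem lip_mul_prod_layerLip_le (hL : 0 < L) (hb : 0 ≤ b) (hs : ∀ ℓ, 0 ≤ s ℓ) :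
    lip * (b * ∏ ℓ, a.layerLip s ℓ) * N ≤ a.gammaFixed lip N b s * a.numParams ^ L := by
  have hprod : ∏ ℓ, a.layerLip s ℓ ≤
      (∏ ℓ, ((a.rho ℓ + 1) * s ℓ + 1)) * (a.numParams : ℝ) ^ L := by
    have : (a.numParams : ℝ) ^ L = ∏ _ℓ : Fin L, (a.numParams : ℝ) := by simp
    rw [this, ← Finset.prod_mul_distrib]
    refine Finset.prod_le_prod (fun ℓ _ => ?_) fun ℓ _ => ?_
    · have := hs ℓ
      unfold layerLip
      positivity
    · have h1 := hs ℓ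
      have h2 : (a.patchDim ℓ : ℝ) ≤ a.numParams := by exact_mod_cast a.patchDim_le_numParams ℓ
      calc a.layerLip s ℓ = a.rho ℓ * s ℓ * a.patchDim ℓ := by unfold layerLip; ring
        _ ≤ ((a.rho ℓ + 1) * s ℓ + 1) * a.numParams := by
          gcongr
          nlinarith
  have hP0 : 0 ≤ ∏ ℓ, ((a.rho ℓ + 1) * s ℓ + 1) :=
    Finset.prod_nonneg fun ℓ _ => by have := hs ℓ; positivity
  have hW : (1 : ℝ) ≤ a.numParams := by exact_mod_cast a.one_le_numParams hL
  have hA : (1 : ℝ) ≤ a.numPreacts := by exact_mod_cast a.one_le_numPreacts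
  have hL' : (1 : ℝ) ≤ L := by exact_mod_cast hL
  have hlip : (lip : ℝ) ≤ L * lip + 1 := by nlinarith [lip.coe_nonneg]
  calc _ ≤ lip * (b * ((∏ ℓ, ((a.rho ℓ + 1) * s ℓ + 1)) * (a.numParams : ℝ) ^ L)) * N := by gcongr
    _ = b * lip * 1 * 1 * N * (∏ ℓ, ((a.rho ℓ + 1) * s ℓ + 1)) * (a.numParams : ℝ) ^ L := by ring
    _ ≤ _ := by
      unfold gammaFixed
      gcongr
      linarith

variable {Y : Type*} [MeasurableSpace Y] {loss : a.Output → Y → ℝ} {lip} {M : ℝ} {r : Fin L → ℕ}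

/-- The uniform deviation bound for filters with entries at most `s` and ranks at most `r`, up to
the mass of the inputs of norm above `b`. -/
theorem measure_exists_gap_gt_le (hL : 0 < L)
    (hloss : Measurable (Function.uncurry loss))
    (hlip : ∀ y, LipschitzWith lip (fun v => loss v y))
    (h0 : ∀ v y, 0 ≤ loss v y) (h1 : ∀ v y, loss v y ≤ M) (hM : 0 ≤ M)
    (D : Measure (a.Input × Y)) [IsProbabilityMeasure D] (hN : 0 < N) (hb : 0 ≤ b)
    (hs : ∀ ℓ, 0 ≤ s ℓ) (hr : ∀ ℓ, r ℓ ≤ a.channels ℓ.succ) {δ : ℝ} (hδ0 : 0 < δ) (hδ1 : δ ≤ 1) :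
    Measure.pi (fun _ : Fin N => D)
      {z | ∃ A : a.Filters, (∀ ℓ j i, |A ℓ j i| ≤ s ℓ) ∧ (∀ ℓ, (A ℓ).rank ≤ r ℓ) ∧
        M * √((Real.log (1 / δ) + a.lowRankCount r * Real.log (10 * (a.numParams : ℝ) ^ 2 *
          (2 * a.numParams) ^ L * a.gammaFixed lip N b s)) / (2 * N)) + 2 / N +
            M * D.real {q | b < l2Norm q.1} < a.gap loss D z A} ≤ ENNReal.ofReal δ := by
  set Γ := a.gammaFixed lip N b s with hΓ
  set W : ℝ := (a.numParams : ℝ) with hWdef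
  have hN' : (0 : ℝ) < N := Nat.cast_pos.2 hN
  have hΓ1 : 1 ≤ Γ := a.one_le_gammaFixed lip hL hN hb hs
  have hW : 1 ≤ W := by rw [hWdef]; exact_mod_cast a.one_le_numParams hL
  -- With `m ≥ x` the relative filter error `2 U r / m` is at most `η = ((2W)^L Γ)⁻¹`, which makes
  -- the loss error at most `1 / N`. Since `x ≥ 1`, also `2m + 1 ≤ 2x + 3 ≤ 5x`.
  set x : ℝ := 2 * W ^ 2 * (2 * W) ^ L * Γ with hx
  have hW2 : (1 : ℝ) ≤ W ^ 2 := one_le_pow₀ hW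
  have hWL : (1 : ℝ) ≤ (2 * W) ^ L := one_le_pow₀ (by linarith)
  have hx1 : 1 ≤ x := by
    rw [hx]
    exact one_le_mul_of_one_le_of_one_le (one_le_mul_of_one_le_of_one_le (by linarith) hWL) hΓ1
  set m := ⌈x⌉₊ with hm
  have hxm : x ≤ m := Nat.le_ceil x
  have hm0 : 0 < m := Nat.ceil_pos.2 (by linarith)
  have hm0' : (0 : ℝ) < m := Nat.cast_pos.2 hm0
  have hm2 : ((2 * m + 1 : ℕ) : ℝ) ≤ 10 * W ^ 2 * (2 * W) ^ L * Γ := by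
    have := Nat.ceil_lt_add_one (show 0 ≤ x by linarith)
    rw [← hm] at this
    have h5 : 10 * W ^ 2 * (2 * W) ^ L * Γ = 5 * x := by rw [hx]; ring
    rw [h5]
    push_cast
    linarith
  set η : ℝ := ((2 * W) ^ L * Γ)⁻¹ with hη
  have hη0 : 0 ≤ η := by positivity
  have hη1 : η ≤ 1 := inv_le_one_of_one_le₀ (one_le_mul_of_one_le_of_one_le hWL hΓ1)
  have hgrid : ∀ ℓ, 2 * (a.channels ℓ.succ : ℝ) * r ℓ / m ≤ η := fun ℓ => by
    have e1 : (a.channels ℓ.succ : ℝ) ≤ W := by rw [hWdef]; exact_mod_cast a.channels_le_numParams ℓ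
    have e2 : (r ℓ : ℝ) ≤ W := by rw [hWdef]; exact_mod_cast (hr ℓ).trans (a.channels_le_numParams ℓ)
    rw [div_le_iff₀ hm0']
    calc 2 * (a.channels ℓ.succ : ℝ) * r ℓ ≤ 2 * W * W := by gcongr
      _ = η * x := by rw [hη, hx]; field_simp
      _ ≤ η * m := by gcongr
  have hfin := CNN.measure_exists_gap_gt_le D hN
    (f := fun k : a.GridIndex r m => a.clippedLoss loss b (a.gridFilters s k))
    (fun k => a.measurable_clippedLoss hloss b _) (M := M)
    (fun k => a.clippedLoss_nonneg h0 b _) (fun k => a.clippedLoss_le hM h1 b _) hδ0 hδ1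
  refine le_trans (measure_mono ?_) hfin
  rintro z ⟨A, hAs, hAr, hgap⟩
  choose k hk using fun ℓ => exists_gridMatrix_near (hs ℓ) hm0 (A ℓ) (hAr ℓ) (hAs ℓ)
  refine ⟨k, ?_⟩
  have hnear : ∀ q : a.Input × Y, l2Norm q.1 ≤ b →
      |loss (a.net A q.1) q.2 - loss (a.net (a.gridFilters s k) q.1) q.2| ≤ 1 / N := fun q hq => by
    have e1 := (hlip q.2).dist_le_mul (a.net A q.1) (a.net (a.gridFilters s k) q.1)
    rw [Real.dist_eq, dist_comm, dist_eq_norm] at e1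
    have e2 := a.norm_net_sub_le hs hη0 hη1 hAs (A' := a.gridFilters s k)
      (fun ℓ j i => (hk ℓ j i).trans (mul_le_mul_of_nonneg_right (hgrid ℓ) (hs ℓ))) q.1
    have hP0 : 0 ≤ ∏ ℓ, a.layerLip s ℓ :=
      Finset.prod_nonneg fun ℓ _ => by have := hs ℓ; unfold layerLip; positivity
    have e3 := a.lip_mul_prod_layerLip_le lip (N := N) hL hb hs
    rw [← hΓ, ← hWdef] at e3
    refine e1.trans ?_
    rw [le_div_iff₀ hN']
    calc _ ≤ lip * (η * 2 ^ L * (b * ∏ ℓ, a.layerLip s ℓ)) * N := by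
          gcongr
          refine e2.trans ?_
          gcongr
          exact (norm_le_l2Norm _).trans hq
      _ = η * 2 ^ L * (lip * (b * ∏ ℓ, a.layerLip s ℓ) * N) := by ring
      _ ≤ η * 2 ^ L * (Γ * W ^ L) := by gcongr
      _ = 1 := by
        rw [hη, mul_pow]
        field_simp
  have hle := a.gap_le_of_near hloss h0 h1 hM D hN (by positivity) hnear z
  have hlog : Real.log (Fintype.card (a.GridIndex r m) / δ) ≤ Real.log (1 / δ) +
      a.lowRankCount r * Real.log (10 * W ^ 2 * (2 * W) ^ L * Γ) := by
    rw [card_gridIndex, Nat.cast_pow, div_eq_mul_one_div, Real.log_mul (by positivity)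
      (by positivity), Real.log_pow, add_comm]
    gcongr
  have hsqrt : M * √(Real.log (Fintype.card (a.GridIndex r m) / δ) / (2 * N)) ≤
      M * √((Real.log (1 / δ) +
        a.lowRankCount r * Real.log (10 * W ^ 2 * (2 * W) ^ L * Γ)) / (2 * N)) := by
    gcongr
  have e : 2 / (N : ℝ) = 2 * (1 / N) := by ring
  rw [e] at hgap
  linarith

end Net

end Architecture

/-! ### Numerical comparison with the stated bound. -/

section Bounds

variable {M δ Γ S : ℝ} {N : ℕ}

theorem le_genBound (hM : 0 ≤ M) (hS : 0 ≤ S) :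
    6 * (M + 1) * √(Real.log (4 / δ) / N) ≤ genBound M δ N Γ S := by
  have := Real.log_natCast_nonneg N
  exact le_add_of_nonneg_right (by positivity)

theorem one_le_log_four_div (hδ0 : 0 < δ) (hδ1 : δ < 1) : 1 ≤ Real.log (4 / δ) := by
  rw [Real.le_log_iff_exp_le (by positivity), le_div_iff₀ hδ0]
  nlinarith [Real.exp_one_lt_d9, Real.exp_pos 1]

theorem le_genBound_one (hM : 0 ≤ M) (hS : 0 ≤ S) (hδ0 : 0 < δ) (hδ1 : δ < 1) :
    M ≤ genBound M δ 1 Γ S := by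
  refine le_trans ?_ (le_genBound hM hS)
  have : 1 ≤ √(Real.log (4 / δ) / (1 : ℕ)) :=
    Real.one_le_sqrt.2 (by simpa using one_le_log_four_div hδ0 hδ1)
  nlinarith

/-- With `G = log₂ (4Γ)` and `X = √G S / √N`, the root is at most `√(log(4/δ)/N) + 2X`, and `2 / N ≤
2X`. There is ample room: `N ≥ 2` gives `208 log N ≥ 100`. -/
theorem deviation_le_genBound (hM : 0 ≤ M) (hδ0 : 0 < δ) (hδ1 : δ < 1) (hN : 2 ≤ N)
    (hΓ : 1 ≤ Γ) (hS : 1 ≤ S) {T p : ℝ}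
    (hT : T ≤ Real.log (4 / δ) + 5 * S ^ 2 * Real.log (4 * Γ))
    (hp : p ≤ √(Real.log (4 / δ) / N)) :
    M * √(T / (2 * N)) + 2 / N + M * p ≤ genBound M δ N Γ S := by
  have hN2 : (2 : ℝ) ≤ N := by exact_mod_cast hN
  have hN0 : (0 : ℝ) < N := by linarith
  have hlog := one_le_log_four_div hδ0 hδ1
  set u := Real.log (4 / δ) with hu
  set g := Real.log (4 * Γ) with hg
  set G := Real.logb 2 (4 * Γ) with hG
  have hl2 := Real.log_two_gt_d9
  have hl2' := Real.log_two_lt_d9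
  have hlN : 0.69 ≤ Real.log N := by
    have := Real.log_le_log two_pos hN2
    linarith
  have hGg : g = G * Real.log 2 := by
    rw [hG, Real.logb, div_mul_cancel₀ _ (by linarith)]
  have hG1 : 1 ≤ G := by
    rw [hG, Real.le_logb_iff_rpow_le one_lt_two (by linarith), Real.rpow_one]
    linarith
  have hsqG : 1 ≤ √G := Real.one_le_sqrt.2 hG1
  set w := √(N : ℝ) with hw
  have hw0 : 0 < w := Real.sqrt_pos.2 hN0
  have hw1 : 1 ≤ w := Real.one_le_sqrt.2 (by linarith)
  have hww : w * w = N := Real.mul_self_sqrt hN0.le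
  have h1 : √(T / (2 * N)) ≤ √(u / N) + 2 * (√G * S / w) := by
    rw [Real.sqrt_le_left (by positivity)]
    have e1 : √(u / N) ^ 2 = u / N := Real.sq_sqrt (by positivity)
    have e2 : (2 * (√G * S / w)) ^ 2 = 4 * G * S ^ 2 / N := by
      rw [mul_pow, div_pow, mul_pow, Real.sq_sqrt (by linarith), sq w, hww]
      ring
    have e3 : T / (2 * N) ≤ u / N + 4 * G * S ^ 2 / N := by
      rw [← add_div, div_le_div_iff₀ (by positivity) hN0]
      have : g ≤ G := by rw [hGg]; nlinarith
      have : 5 * S ^ 2 * g ≤ 5 * S ^ 2 * G := by gcongr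
      have e4 : 0 ≤ S ^ 2 * G := by positivity
      nlinarith
    have e5 : 0 ≤ √(u / N) * (2 * (√G * S / w)) := by positivity
    nlinarith
  have h2 : 2 / (N : ℝ) ≤ 2 * (√G * S / w) := by
    rw [← hww, ← mul_div_assoc, div_le_div_iff₀ (by positivity) hw0]
    have : 1 ≤ √G * S := one_le_mul_of_one_le_of_one_le hsqG hS
    nlinarith [mul_pos hw0 hw0]
  have h3 : 100 * ((M + 1) * (√G * S / w)) ≤ 208 * √G * Real.log N * (M + 1) / w * S := by
    have e : 208 * √G * Real.log N * (M + 1) / w * S =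
        (208 * Real.log N) * ((M + 1) * (√G * S / w)) := by ring
    rw [e]
    gcongr
    linarith
  have h4 : 0 ≤ √G * S / w := by positivity
  have h5 : 0 ≤ √(u / N) := Real.sqrt_nonneg _
  have h6 := mul_le_mul_of_nonneg_left h1 hM
  have h7 := mul_le_mul_of_nonneg_left hp hM
  have h8 := mul_nonneg hM h4
  have h9 := mul_nonneg hM h5
  unfold genBound
  linarith

end Bounds

theorem eq_zero_of_rank_eq_zero {m n : ℕ} {A : Matrix (Fin m) (Fin n) ℝ} (h : A.rank = 0) :
    A = 0 := by
  have hA := Submodule.finrank_eq_zero.1 h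
  exact (Matrix.toLin' (R := ℝ)).map_eq_zero_iff.1 (LinearMap.range_eq_bot.1 hA)

/-! ### The a priori bound. -/

namespace Architecture

variable {L : ℕ} (a : Architecture L) {Y : Type*} [MeasurableSpace Y] {loss : a.Output → Y → ℝ}
  {lip : ℝ≥0} {M : ℝ} {D : Measure (a.Input × Y)} [IsProbabilityMeasure D] {N : ℕ} {δ : ℝ}

theorem gap_le (h0 : ∀ v y, 0 ≤ loss v y) (h1 : ∀ v y, loss v y ≤ M)
    (z : Fin N → a.Input × Y) (A : a.Filters) : a.gap loss D z A ≤ M := by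
  have hI : (∫ q, loss (a.net A q.1) q.2 ∂D) ≤ M := by
    refine (integral_mono_of_nonneg (ae_of_all _ fun q => h0 _ _) (integrable_const M)
      (ae_of_all _ fun q => h1 _ _)).trans_eq ?_
    simp
  have hS : 0 ≤ (1 / (N : ℝ)) * ∑ i, loss (a.net A (z i).1) (z i).2 :=
    mul_nonneg (by positivity) (Finset.sum_nonneg fun i _ => h0 _ _)
  rw [gap]
  linarith

/-- The deviation bound for the networks one of whose filters vanishes. -/
theorem measure_exists_gap_gt_le_of_zero (hloss : Measurable (Function.uncurry loss))
    (h0 : ∀ v y, 0 ≤ loss v y) (h1 : ∀ v y, loss v y ≤ M) (hN : 0 < N) (hδ0 : 0 < δ)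
    (hδ1 : δ ≤ 1) :
    Measure.pi (fun _ : Fin N => D)
      {z | ∃ A : a.Filters, (∃ ℓ, A ℓ = 0) ∧
        M * √(Real.log (1 / δ) / (2 * N)) < a.gap loss D z A} ≤ ENNReal.ofReal δ := by
  have h := CNN.measure_exists_gap_gt_le D hN (ι := Unit) (f := fun _ q => loss 0 q.2)
    (fun _ => hloss.comp (measurable_const.prodMk measurable_snd)) (M := M)
    (fun _ _ => h0 _ _) (fun _ _ => h1 _ _) hδ0 hδ1
  refine le_trans (measure_mono ?_) h
  rintro z ⟨A, ⟨ℓ, hℓ⟩, hA⟩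
  refine ⟨(), ?_⟩
  simpa [gap, a.net_eq_zero hℓ] using hA

/-- The a priori bound. -/
theorem measure_constrained_gap_gt_le (hL : 0 < L) (hloss : Measurable (Function.uncurry loss))
    (hlip : ∀ y, LipschitzWith lip (fun v => loss v y))
    (h0 : ∀ v y, 0 ≤ loss v y) (h1 : ∀ v y, loss v y ≤ M) (hM : 0 ≤ M) (hN : 2 ≤ N) (hδ0 : 0 < δ)
    (hδ1 : δ < 1) {b : ℝ} {s : Fin L → ℝ} {r : Fin L → ℕ} (hb : ∀ᵐ q ∂D, l2Norm q.1 ≤ b) :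
    Measure.pi (fun _ : Fin N => D)
      {z | ¬ ∀ A : a.Filters, a.Constrained s r A →
        a.gap loss D z A ≤ genBound M δ N (a.gammaFixed lip N b s) (a.lowRankCount r)} ≤
      ENNReal.ofReal δ := by
  have hN0 : 0 < N := by omega
  have hlog := one_le_log_four_div hδ0 hδ1
  have hlog' : Real.log (1 / δ) ≤ Real.log (4 / δ) :=
    Real.log_le_log (by positivity) (by gcongr; norm_num)
  have hlog0 : 0 ≤ Real.log (1 / δ) := Real.log_nonneg (one_le_one_div hδ0 hδ1.le)
  -- With a zero rank, `S ≥ 2L` can fail, but the network is then zero.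
  by_cases hr0 : ∃ ℓ, r ℓ = 0
  · obtain ⟨ℓ, hℓ⟩ := hr0
    refine le_trans (measure_mono ?_)
      (a.measure_exists_gap_gt_le_of_zero (D := D) hloss h0 h1 hN0 hδ0 hδ1.le)
    intro z hz
    rw [Set.mem_ofPred_eq] at hz
    push Not at hz
    obtain ⟨A, hA, hgap⟩ := hz
    refine ⟨A, ⟨ℓ, ?_⟩, lt_of_le_of_lt ?_ hgap⟩
    · exact eq_zero_of_rank_eq_zero (Nat.le_zero.1 (hℓ ▸ hA.2.2 ℓ))
    · refine le_trans ?_ (le_genBound hM (Nat.cast_nonneg _))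
      have : √(Real.log (1 / δ) / (2 * N)) ≤ √(Real.log (4 / δ) / N) := by
        gcongr
        have : (0 : ℝ) < N := Nat.cast_pos.2 hN0
        linarith
      have h' := Real.sqrt_nonneg (Real.log (4 / δ) / N)
      nlinarith
  push Not at hr0
  by_cases hs : ∀ ℓ, 0 ≤ s ℓ
  swap
  · push Not at hs
    obtain ⟨ℓ, hℓ⟩ := hs
    have hempty : {z : Fin N → a.Input × Y | ¬ ∀ A : a.Filters, a.Constrained s r A →
        a.gap loss D z A ≤ genBound M δ N (a.gammaFixed lip N b s) (a.lowRankCount r)} = ∅ :=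
      Set.eq_empty_iff_forall_notMem.2 fun z hz => hz fun A hA =>
        absurd ((abs_nonneg _).trans
          (hA.abs_apply_le ℓ ⟨0, a.channels_pos _⟩ ⟨0, a.patchDim_pos _⟩)) (not_le.2 hℓ)
    rw [hempty, measure_empty]
    exact zero_le
  have hb0 : 0 ≤ b := by
    obtain ⟨q, hq⟩ := hb.exists
    exact (l2Norm_nonneg _).trans hq
  have hp : D.real {q | b < l2Norm q.1} = 0 := by
    rw [measureReal_def, show D {q | b < l2Norm q.1} = 0 by simpa [ae_iff] using hb,
      ENNReal.toReal_zero]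
  -- The grid estimate needs ranks at most `U_ℓ`; capping excludes no matrix and does not increase
  -- `S`.
  set r' : Fin L → ℕ := fun ℓ => min (r ℓ) (a.channels ℓ.succ) with hr'
  have hr'1 : ∀ ℓ, 1 ≤ r' ℓ := fun ℓ =>
    le_min (Nat.one_le_iff_ne_zero.2 (hr0 ℓ)) (a.channels_pos _)
  refine le_trans (measure_mono ?_) (a.measure_exists_gap_gt_le hL hloss hlip h0 h1 hM D hN0 hb0 hs
    (r := r') (fun ℓ => min_le_right _ _) hδ0 hδ1.le)
  intro z hz
  rw [Set.mem_ofPred_eq] at hz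
  push Not at hz
  obtain ⟨A, hA, hgap⟩ := hz
  refine ⟨A, hA.abs_apply_le, fun ℓ => le_min (hA.2.2 ℓ) ?_, lt_of_le_of_lt ?_ hgap⟩
  · simpa using (A ℓ).rank_le_card_height
  have hΓ1 := a.one_le_gammaFixed lip hL hN0 hb0 hs
  have hWΓ := a.numParams_le_gammaFixed lip hN0 hb0 hs
  have hW : (1 : ℝ) ≤ a.numParams := by exact_mod_cast a.one_le_numParams hL
  have hS2 : (2 * L : ℝ) ≤ a.lowRankCount r := by
    exact_mod_cast (a.two_mul_le_lowRankCount hr'1).trans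
      (a.lowRankCount_mono fun ℓ => min_le_left _ _)
  have hSS : (a.lowRankCount r' : ℝ) ≤ a.lowRankCount r := by
    exact_mod_cast a.lowRankCount_mono fun ℓ => min_le_left _ _
  have hL' : (1 : ℝ) ≤ L := by exact_mod_cast hL
  set Γ := a.gammaFixed lip N b s
  set W : ℝ := (a.numParams : ℝ)
  set S : ℝ := (a.lowRankCount r : ℝ)
  refine deviation_le_genBound hM hδ0 hδ1 hN hΓ1 (by linarith) ?_ (hp ▸ Real.sqrt_nonneg _)
  have hX : Real.log (10 * W ^ 2 * (2 * W) ^ L * Γ) ≤ (L + 5 : ℕ) * Real.log (4 * Γ) := by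
    rw [← Real.log_pow]
    refine Real.log_le_log (by positivity) ?_
    calc 10 * W ^ 2 * (2 * W) ^ L * Γ
        ≤ (4 * Γ) ^ 2 * (4 * Γ) ^ 2 * (4 * Γ) ^ L * (4 * Γ) := by
          gcongr
          · nlinarith
          · linarith
          · linarith
          · linarith
      _ = (4 * Γ) ^ (L + 5) := by ring
  have hg : 0 ≤ Real.log (4 * Γ) := Real.log_nonneg (by linarith)
  have hX' : (a.lowRankCount r' : ℝ) * Real.log (10 * W ^ 2 * (2 * W) ^ L * Γ) ≤
      S * ((L + 5 : ℕ) * Real.log (4 * Γ)) :=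
    mul_le_mul_of_nonneg hSS hX (Nat.cast_nonneg _) (by positivity)
  push_cast at hX'
  -- Here `S ≥ 2L ≥ 2` turns `L + 5` into at most `5 S`.
  have hLS : S * ((L + 5) * Real.log (4 * Γ)) ≤ 5 * S ^ 2 * Real.log (4 * Γ) := by
    have : S * (L + 5) ≤ 5 * S ^ 2 := by nlinarith
    nlinarith
  linarith

/-! ### Comparison of the two logarithmic constants. -/

/-- All factors of the constant are at least 1. This bounds `ρ_ℓ + 1` and `‖A_ℓ‖` separately by
`Γ_R`. -/
theorem gammaPostHoc_factor_le {B : ℝ} (hL : 0 < L) (hN : 0 < N) (hB : 0 ≤ B) (A : a.Filters)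
    (ℓ : Fin L) : (a.rho ℓ + 1) * (spectralNorm (A ℓ) + 2) + 1 ≤ a.gammaPostHoc lip N B A := by
  have hf : ∀ ℓ : Fin L, (1 : ℝ) ≤ (a.rho ℓ + 1) * (spectralNorm (A ℓ) + 2) + 1 := fun ℓ => by
    have := spectralNorm_nonneg (A ℓ)
    exact le_add_of_nonneg_left (by positivity)
  have hW : (1 : ℝ) ≤ a.numParams := by exact_mod_cast a.one_le_numParams hL
  have hA : (1 : ℝ) ≤ a.numPreacts := by exact_mod_cast a.one_le_numPreacts
  have hN' : (1 : ℝ) ≤ N := by exact_mod_cast hN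
  have h1 : (1 : ℝ) ≤ B + 2 := by linarith
  have h2 : (1 : ℝ) ≤ L * lip + 1 := le_add_of_nonneg_left (by positivity)
  have hP : (a.rho ℓ + 1) * (spectralNorm (A ℓ) + 2) + 1 ≤
      ∏ ℓ, ((a.rho ℓ + 1) * (spectralNorm (A ℓ) + 2) + 1) := by
    rw [← Finset.mul_prod_erase _ _ (Finset.mem_univ ℓ)]
    exact le_mul_of_one_le_right (zero_le_one.trans (hf ℓ)) (Finset.one_le_prod fun ℓ _ => hf ℓ)
  have hP0 := (zero_le_one.trans (hf ℓ)).trans hP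
  unfold gammaPostHoc
  calc _ ≤ 1 * 1 * 1 * 1 * 1 * ∏ ℓ, ((a.rho ℓ + 1) * (spectralNorm (A ℓ) + 2) + 1) := by
        simpa using hP
    _ ≤ _ := by gcongr

theorem numParams_le_gammaPostHoc {B : ℝ} (hN : 0 < N) (hB : 0 ≤ B) (A : a.Filters) :
    (a.numParams : ℝ) ≤ a.gammaPostHoc lip N B A := by
  have hP : (1 : ℝ) ≤ ∏ ℓ, ((a.rho ℓ + 1) * (spectralNorm (A ℓ) + 2) + 1) :=
    Finset.one_le_prod fun ℓ _ => by
      have := spectralNorm_nonneg (A ℓ)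
      exact le_add_of_nonneg_left (by positivity)
  have hA : (1 : ℝ) ≤ a.numPreacts := by exact_mod_cast a.one_le_numPreacts
  have hN' : (1 : ℝ) ≤ N := by exact_mod_cast hN
  have h1 : (1 : ℝ) ≤ B + 2 := by linarith
  have h2 : (1 : ℝ) ≤ L * lip + 1 := le_add_of_nonneg_left (by positivity)
  unfold gammaPostHoc
  calc (a.numParams : ℝ) = 1 * 1 * a.numParams * 1 * 1 * 1 := by ring
    _ ≤ _ := by gcongr

/-- The a priori constant for a uniform norm bound `c` that is at most twice the post hoc constant is
polynomial in the latter. -/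
theorem gammaFixed_le_gammaPostHoc {B b c : ℝ} (hL : 0 < L) (hN : 0 < N) (hB : 0 ≤ B)
    (hb0 : 0 ≤ b) (hb : b ≤ B + 1) {A : a.Filters} (hc0 : 0 ≤ c)
    (hc : c ≤ 2 * a.gammaPostHoc lip N B A) :
    a.gammaFixed lip N b (fun _ => c) ≤
      a.gammaPostHoc lip N B A * (4 * a.gammaPostHoc lip N B A) ^ (2 * L) := by
  have hfac := fun ℓ => a.gammaPostHoc_factor_le (lip := lip) hL hN hB A ℓ
  have hP1 : (1 : ℝ) ≤ ∏ ℓ, ((a.rho ℓ + 1) * (spectralNorm (A ℓ) + 2) + 1) :=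
    Finset.one_le_prod fun ℓ _ => by
      have := spectralNorm_nonneg (A ℓ)
      exact le_add_of_nonneg_left (by positivity)
  have hprod : ∏ ℓ : Fin L, ((a.rho ℓ + 1) * c + 1) ≤
      (4 * a.gammaPostHoc lip N B A) ^ (2 * L) := by
    rw [pow_mul, show ((4 * a.gammaPostHoc lip N B A) ^ 2) ^ L =
      ∏ _ℓ : Fin L, (4 * a.gammaPostHoc lip N B A) ^ 2 by simp]
    refine Finset.prod_le_prod (fun ℓ _ => by positivity) fun ℓ _ => ?_
    have h1 := hfac ℓ
    have h2 := spectralNorm_nonneg (A ℓ)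
    have h3 := (a.rho ℓ).coe_nonneg
    have h4 : (a.rho ℓ : ℝ) + 1 ≤ a.gammaPostHoc lip N B A := by nlinarith
    have h5 : ((a.rho ℓ : ℝ) + 1) * c ≤
        a.gammaPostHoc lip N B A * (2 * a.gammaPostHoc lip N B A) :=
      mul_le_mul h4 hc hc0 (by linarith)
    nlinarith
  -- The shift `𝔅 + 2` in the post hoc constant absorbs `b ≤ 𝔅 + 1`.
  have hpre : (b + 1) * (L * lip + 1) * a.numParams * a.numPreacts * N ≤
      a.gammaPostHoc lip N B A := by
    unfold gammaPostHoc
    refine le_trans ?_ (le_mul_of_one_le_right (by positivity) hP1)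
    gcongr ?_ * _ * _ * _ * _
    linarith
  unfold gammaFixed
  refine mul_le_mul hpre hprod (Finset.prod_nonneg fun ℓ _ => by positivity) ?_
  exact le_trans (by positivity) hpre

end Architecture

/-! ### The post hoc bound. -/

namespace Architecture

variable {L : ℕ} (a : Architecture L) {Y : Type*} [MeasurableSpace Y] {loss : a.Output → Y → ℝ}
  {lip : ℝ≥0} {M : ℝ} {D : Measure (a.Input × Y)} [IsProbabilityMeasure D] {N : ℕ} {δ : ℝ}

/-- There is a power of two that bounds all filter entries and is at most twice the post hoc
constant. -/
theorem exists_pow_two_bound {B : ℝ} (hL : 0 < L) (hN : 0 < N) (hB : 0 ≤ B) (A : a.Filters) :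
    ∃ n : ℕ, (∀ ℓ j i, |A ℓ j i| ≤ 2 ^ n) ∧
      (2 : ℝ) ^ n ≤ 2 * a.gammaPostHoc lip N B A := by
  have : Nonempty (Fin L) := ⟨⟨0, hL⟩⟩
  obtain ⟨ℓ₀, hℓ₀⟩ := Finite.exists_max fun ℓ => spectralNorm (A ℓ)
  have h0 := spectralNorm_nonneg (A ℓ₀)
  -- Adding 1 makes the argument at least 1, so that a natural exponent exists; the next power of
  -- two is then at most `2 (‖A‖ + 1)`.
  obtain ⟨n, hn1, hn2⟩ := exists_nat_pow_near (x := spectralNorm (A ℓ₀) + 1) (by linarith)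
    (one_lt_two : (1 : ℝ) < 2)
  refine ⟨n + 1, fun ℓ j i => ?_, ?_⟩
  · have := abs_apply_le_spectralNorm (A ℓ) j i
    linarith [hℓ₀ ℓ]
  · have h1 := a.gammaPostHoc_factor_le (lip := lip) hL hN hB A ℓ₀
    have h2 := (a.rho ℓ₀).coe_nonneg
    rw [pow_succ]
    nlinarith

/-- The post hoc bound. -/
theorem measure_gap_gt_le (hL : 0 < L) (hloss : Measurable (Function.uncurry loss))
    (hlip : ∀ y, LipschitzWith lip (fun v => loss v y))
    (h0 : ∀ v y, 0 ≤ loss v y) (h1 : ∀ v y, loss v y ≤ M) (hM : 0 ≤ M) (hN : 2 ≤ N) (hδ0 : 0 < δ)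
    (hδ1 : δ < 1) :
    Measure.pi (fun _ : Fin N => D)
      {z | ¬ ∀ A : a.Filters,
        a.gap loss D z A ≤ genBound M δ N (a.gammaPostHoc lip N (sampleRadius z) A)
          (a.lowRankCount fun ℓ => (A ℓ).rank)} ≤ ENNReal.ofReal δ := by
  have hN0 : 0 < N := by omega
  have hN' : (0 : ℝ) < N := Nat.cast_pos.2 hN0
  have hlog := one_le_log_four_div hδ0 hδ1
  set ε : ℝ := Real.log (4 / δ) / N with hε
  have hε0 : 0 < ε := by positivity
  have hρ : Measurable fun q : a.Input × Y => l2Norm q.1 := measurable_l2Norm.comp measurable_fst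
  obtain ⟨K, hK, hKN⟩ := exists_tail_level D hρ (fun q => l2Norm_nonneg q.1) N hε0
  have hexp : Real.exp (-(ε * N)) = δ / 4 := by
    rw [hε, div_mul_cancel₀ _ hN'.ne', Real.exp_neg, Real.exp_log (by positivity), inv_div]
  rw [hexp] at hKN
  -- The tail mass `p` satisfies `p ≤ ε` and `p ≤ 1`, hence `p² ≤ ε`.
  have hp : D.real {q | (K : ℝ) < l2Norm q.1} ≤ √ε := by
    refine Real.le_sqrt_of_sq_le ?_
    have h3 : D.real {q | (K : ℝ) < l2Norm q.1} ≤ 1 := measureReal_le_one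
    have h4 : 0 ≤ D.real {q | (K : ℝ) < l2Norm q.1} := measureReal_nonneg
    nlinarith
  let R : Type := ∀ ℓ : Fin L, Fin (a.channels ℓ.succ + 1)
  have hR : (1 : ℝ) ≤ Fintype.card R := by exact_mod_cast Fintype.card_pos
  -- The failure probability splits as `δ/4` for a vanishing filter, `δ/4` for a sample with all
  -- norms below `K - 1`, and `δ/2` for the family below, spread geometrically over `n` and
  -- uniformly over rank vectors.
  let δ' : ℕ → ℝ := fun n => δ / 2 / 2 / 2 ^ n / Fintype.card R
  have hδ'0 : ∀ n, 0 < δ' n := fun n => by positivity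
  have hδ'1 : ∀ n, δ' n ≤ 1 := fun n => by
    refine div_le_one_of_le₀ ((div_le_self (by positivity) ?_).trans ?_) (by positivity)
    · exact one_le_pow₀ one_le_two
    · linarith
  set E₁ : Set (Fin N → a.Input × Y) := {z | ∃ A : a.Filters, (∃ ℓ, A ℓ = 0) ∧
    M * √(Real.log (1 / (δ / 4)) / (2 * N)) < a.gap loss D z A} with hE₁
  set E₂ : Set (Fin N → a.Input × Y) := {z | ∀ i, l2Norm (z i).1 + 1 < K} with hE₂
  let E₃ : ℕ → R → Set (Fin N → a.Input × Y) := fun n r =>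
    {z | ∃ A : a.Filters, (∀ ℓ j i, |A ℓ j i| ≤ 2 ^ n) ∧ (∀ ℓ, (A ℓ).rank ≤ r ℓ) ∧
      M * √((Real.log (1 / δ' n) + a.lowRankCount (fun ℓ => r ℓ) *
        Real.log (10 * (a.numParams : ℝ) ^ 2 * (2 * a.numParams) ^ L *
          a.gammaFixed lip N K (fun _ => 2 ^ n))) / (2 * N)) + 2 / N +
            M * D.real {q | (K : ℝ) < l2Norm q.1} < a.gap loss D z A}
  have hm₁ : Measure.pi (fun _ : Fin N => D) E₁ ≤ ENNReal.ofReal (δ / 4) :=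
    a.measure_exists_gap_gt_le_of_zero hloss h0 h1 hN0 (by positivity) (by linarith)
  have hm₃ : Measure.pi (fun _ : Fin N => D) (⋃ n, ⋃ r, E₃ n r) ≤ ENNReal.ofReal (δ / 2) :=
    measure_iUnion_le_of_geometric _ (by positivity) fun n r =>
      a.measure_exists_gap_gt_le hL hloss hlip h0 h1 hM D hN0 (Nat.cast_nonneg K)
        (fun _ => by positivity) (fun ℓ => Nat.lt_succ_iff.1 (r ℓ).2) (hδ'0 n) (hδ'1 n)
  have hsum : ENNReal.ofReal (δ / 4) + (ENNReal.ofReal (δ / 4) + ENNReal.ofReal (δ / 2)) =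
      ENNReal.ofReal δ := by
    rw [← ENNReal.ofReal_add (by positivity) (by positivity),
      ← ENNReal.ofReal_add (by positivity) (by positivity)]
    congr 1
    ring
  rw [← hsum]
  refine le_trans (measure_mono (t := E₁ ∪ (E₂ ∪ ⋃ n, ⋃ r, E₃ n r)) ?_)
    ((measure_union_le _ _).trans (add_le_add hm₁
      ((measure_union_le _ _).trans (add_le_add hKN hm₃))))
  intro z hz
  rw [Set.mem_ofPred_eq] at hz
  push Not at hz
  obtain ⟨A, hgap⟩ := hz
  by_cases hA : ∃ ℓ, A ℓ = 0
  · refine Or.inl ⟨A, hA, lt_of_le_of_lt ?_ hgap⟩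
    refine le_trans ?_ (le_genBound hM (Nat.cast_nonneg _))
    have h3 : √(Real.log (1 / (δ / 4)) / (2 * N)) ≤ √ε := by
      rw [one_div_div, hε]
      gcongr
      linarith
    have h4 := Real.sqrt_nonneg ε
    nlinarith
  by_cases hKz : z ∈ E₂
  · exact Or.inr (Or.inl hKz)
  refine Or.inr (Or.inr ?_)
  push Not at hA
  -- Outside `E₂` some sample has norm at least `K - 1`, so `K ≤ 𝔅 + 1`.
  have hKz' : ∃ i, (K : ℝ) ≤ l2Norm (z i).1 + 1 := by
    by_contra! hcon
    exact hKz hcon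
  obtain ⟨i₀, hi₀⟩ := hKz'
  have hBi : l2Norm (z i₀).1 ≤ sampleRadius z :=
    le_ciSup (f := fun i => l2Norm (z i).1) (Set.finite_range _).bddAbove i₀
  set B := sampleRadius z
  have hB0 : 0 ≤ B := (l2Norm_nonneg _).trans hBi
  obtain ⟨n, hn1, hn2⟩ := a.exists_pow_two_bound (lip := lip) hL hN0 hB0 A
  have hr1 : ∀ ℓ, 1 ≤ (A ℓ).rank := fun ℓ =>
    Nat.one_le_iff_ne_zero.2 fun h => hA ℓ (eq_zero_of_rank_eq_zero h)
  let r : R := fun ℓ => ⟨(A ℓ).rank, Nat.lt_succ_iff.2 (by simpa using (A ℓ).rank_le_card_height)⟩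
  refine Set.mem_iUnion.2 ⟨n, Set.mem_iUnion.2 ⟨r, A, hn1, fun ℓ => le_rfl,
    lt_of_le_of_lt ?_ hgap⟩⟩
  have hWΓ := a.numParams_le_gammaPostHoc (lip := lip) hN0 hB0 A
  have hFΓ := a.gammaFixed_le_gammaPostHoc (lip := lip) (A := A) (c := 2 ^ n) hL hN0 hB0
    (Nat.cast_nonneg K) (by linarith) (by positivity) hn2
  have hF1 := a.one_le_gammaFixed lip (s := fun _ => 2 ^ n) hL hN0 (Nat.cast_nonneg K)
    fun _ => by positivity
  have hW : (1 : ℝ) ≤ a.numParams := by exact_mod_cast a.one_le_numParams hL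
  have hS2 : (2 * L : ℝ) ≤ a.lowRankCount fun ℓ => (A ℓ).rank := by
    exact_mod_cast a.two_mul_le_lowRankCount hr1
  have hL' : (1 : ℝ) ≤ L := by exact_mod_cast hL
  have hRΓ : (Fintype.card R : ℝ) ≤ (4 * a.gammaPostHoc lip N B A) ^ L := by
    rw [Fintype.card_pi, show (4 * a.gammaPostHoc lip N B A) ^ L =
      ∏ _ℓ : Fin L, (4 * a.gammaPostHoc lip N B A) by simp, Nat.cast_prod]
    refine Finset.prod_le_prod (fun ℓ _ => Nat.cast_nonneg _) fun ℓ _ => ?_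
    have : (a.channels ℓ.succ : ℝ) ≤ a.numParams := by exact_mod_cast a.channels_le_numParams ℓ
    rw [Fintype.card_fin]
    push_cast
    linarith
  change M * √((Real.log (1 / δ' n) + (a.lowRankCount fun ℓ => (A ℓ).rank) * _) / (2 * N)) + _ + _
    ≤ _
  set Γ := a.gammaPostHoc lip N B A
  set F := a.gammaFixed lip N K (fun _ => 2 ^ n)
  set W : ℝ := (a.numParams : ℝ)
  set S : ℝ := ((a.lowRankCount fun ℓ => (A ℓ).rank : ℕ) : ℝ)
  have hΓ1 : 1 ≤ Γ := hW.trans hWΓ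
  have hg : 0 ≤ Real.log (4 * Γ) := Real.log_nonneg (by linarith)
  refine deviation_le_genBound hM hδ0 hδ1 hN hΓ1 (by linarith) ?_ hp
  have hX : Real.log (10 * W ^ 2 * (2 * W) ^ L * F) ≤ (3 * L + 5 : ℕ) * Real.log (4 * Γ) := by
    rw [← Real.log_pow]
    refine Real.log_le_log (by positivity) ?_
    calc 10 * W ^ 2 * (2 * W) ^ L * F
        ≤ (4 * Γ) ^ 2 * (4 * Γ) ^ 2 * (4 * Γ) ^ L * (4 * Γ * (4 * Γ) ^ (2 * L)) := by
          have hFΓ' : F ≤ 4 * Γ * (4 * Γ) ^ (2 * L) := by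
            refine hFΓ.trans ?_
            gcongr
            linarith
          gcongr
          · nlinarith
          · linarith
          · linarith
      _ = (4 * Γ) ^ (3 * L + 5) := by ring
  -- The union bound costs `|R| 2^n`, which is at most `(4Γ)^(L+1)`.
  have hδ' : Real.log (1 / δ' n) ≤ Real.log (4 / δ) + (L + 1 : ℕ) * Real.log (4 * Γ) := by
    rw [← Real.log_pow, ← Real.log_mul (by positivity) (by positivity)]
    refine Real.log_le_log (by positivity) ?_
    have e : 1 / δ' n = 4 / δ * (Fintype.card R * 2 ^ n) := by
      simp only [δ']
      field_simp
      norm_num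
    rw [e, pow_succ]
    gcongr
    linarith
  have hX' := mul_le_mul_of_nonneg_left hX (show 0 ≤ S by positivity)
  push_cast at hX' hδ'
  -- By `L ≤ S / 2` and `S ≥ 2`; the constant 5 of `deviation_le_genBound` suffices here.
  have hLS : (L + 1) + S * (3 * L + 5) ≤ 5 * S ^ 2 := by nlinarith
  have := mul_le_mul_of_nonneg_right hLS hg
  linarith

end Architecture

end CNN

theorem mainTheorem10 {L : ℕ} (hL : 0 < L) (a : CNN.Architecture L)
    {Y : Type*} [MeasurableSpace Y]
    (loss : a.Output → Y → ℝ) (lip : ℝ≥0) (M : ℝ)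
    (loss_measurable : Measurable (Function.uncurry loss))
    (loss_lipschitz : ∀ y, LipschitzWith lip (fun v => loss v y))
    (loss_nonneg : ∀ v y, 0 ≤ loss v y) (loss_le : ∀ v y, loss v y ≤ M)
    (D : Measure (a.Input × Y)) [IsProbabilityMeasure D]
    {N : ℕ} (hN : 0 < N) (δ : ℝ) (hδ0 : 0 < δ) (hδ1 : δ < 1) :
    -- A priori version, for fixed bounds on the inputs, the norms and the ranks.
    (∀ (b : ℝ) (s : Fin L → ℝ) (r : Fin L → ℕ), (∀ᵐ q ∂D, CNN.l2Norm q.1 ≤ b) →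
      Measure.pi (fun _ : Fin N => D)
        {z | ¬ ∀ A : a.Filters, a.Constrained s r A →
          a.gap loss D z A ≤
            CNN.genBound M δ N (a.gammaFixed lip N b s) (a.lowRankCount r)}
        ≤ ENNReal.ofReal δ) ∧
    -- Post hoc version, simultaneously over all networks of the architecture.
    Measure.pi (fun _ : Fin N => D)
      {z | ¬ ∀ A : a.Filters,
        a.gap loss D z A ≤
          CNN.genBound M δ N (a.gammaPostHoc lip N (CNN.sampleRadius z) A)
            (a.lowRankCount fun ℓ => (A ℓ).rank)}
      ≤ ENNReal.ofReal δ := by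
  obtain ⟨q₀⟩ : Nonempty (a.Input × Y) := nonempty_of_isProbabilityMeasure D
  have hM : 0 ≤ M := (loss_nonneg 0 q₀.2).trans (loss_le 0 q₀.2)
  -- For `N = 1` the factor `log N` kills the complexity term, but the first term already exceeds
  -- `M`, the trivial bound on the gap.
  rcases (Nat.succ_le_iff.2 hN).eq_or_lt with rfl | hN2
  · have h : ∀ z A (Γ : ℝ) (S : ℕ), a.gap (N := 1) loss D z A ≤ CNN.genBound M δ 1 Γ S :=
      fun z A Γ S => (a.gap_le loss_nonneg loss_le z A).trans
        (CNN.le_genBound_one hM (Nat.cast_nonneg S) hδ0 hδ1)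
    exact ⟨fun b s r _ => by simp [h], by simp [h]⟩
  · exact ⟨fun b s r hb => a.measure_constrained_gap_gt_le hL loss_measurable loss_lipschitz
      loss_nonneg loss_le hM hN2 hδ0 hδ1 hb,
      a.measure_gap_gt_le hL loss_measurable loss_lipschitz loss_nonneg loss_le hM hN2 hδ0 hδ1⟩
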